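/- Let $z_0,\alpha,\beta\in\mathbb C$. For an equation $y''=F(z,y)$ with initial data $y(z_0)=\alpha$, $y'(z_0)=\beta$, an analytic solution on a domain $U$ (an open connected subset of $\mathbb C$ containing $z_0$) is a single-valued analytic function on $U$ that satisfies the equation on $U$ and the initial data. It is called maximally extended, with domain of analyticity $U$, if it is not the restriction of an analytic solution on a domain strictly larger than $U$. Let $y_I$ be a maximally extended solution, with domain of analyticity $\Omega$, of $$P_I:\quad y''=6y^2+z,\qquad y(z_0)=\alpha,\ y'(z_0)=\beta,$$ and, for every $\epsilon\in\mathbb C$, let $y(\cdot,\epsilon)$ be a maximally extended solution, with domain of analyticity $U_\epsilon$, of $$P_{II}(\epsilon):\quad y''=6y^2+z+\epsilon^6\,(2y^3+zy),\qquad y(z_0)=\alpha,\ y'(z_0)=\beta .$$ Then for every compact set $K\subset\Omega$ there is $r_K>0$ such that $K\subset U_\epsilon$ whenever $|\epsilon|<r_K$, and $(z,\epsilon)\mapsto y(z,\epsilon)$ is (jointly) analytic at every point of $K\times\{\epsilon\in\mathbb C:|\epsilon|<r_K\}$. Moreover $y(\cdot,\epsilon)\to y_I$ uniformly on $K$ as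 $\epsilon\to 0$. -/

import Mathlib

open Set Filter Topology

/-- Right-hand side of the first Painlevé equation `y'' = 6 y² + z`. -/
def painleveOneRHS (z w : ℂ) : ℂ := 6 * w ^ 2 + z

/-- Right-hand side of the rescaled second Painlevé equation
`y'' = 6 y² + z + ε⁶ (2 y³ + z y)`. -/
def painleveTwoRHS (ε z w : ℂ) : ℂ := 6 * w ^ 2 + z + ε ^ 6 * (2 * w ^ 3 + z * w)

/-- `f` is a (single-valued) analytic solution, on the domain `U ⊆ ℂ` containing `z₀`, of
`y'' = F(z, y)`, `y(z₀) = α`, `y'(z₀) = β`. The values of `f` off `U` are irrelevant. -/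
structure IsAnalyticSolutionOn (F : ℂ → ℂ → ℂ) (z₀ α β : ℂ) (U : Set ℂ) (f : ℂ → ℂ) :
    Prop where
  isOpen : IsOpen U
  isConnected : IsConnected U
  mem : z₀ ∈ U
  analytic : AnalyticOnNhd ℂ f U
  ode : ∀ z ∈ U, deriv (deriv f) z = F z (f z)
  initial_value : f z₀ = α
  initial_deriv : deriv f z₀ = β

/-- `f` is a maximally extended solution of the initial value problem, with domain of
analyticity `U`: it is an analytic solution on `U`, and no analytic solution on a domain
strictly larger than `U` extends it. -/
structure IsMaximalAnalyticSolution (F : ℂ → ℂ → ℂ) (z₀ α β : ℂ) (U : Set ℂ) (f : ℂ → ℂ) :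
    Prop where
  isSolution : IsAnalyticSolutionOn F z₀ α β U f
  maximal : ∀ (V : Set ℂ) (g : ℂ → ℂ), IsAnalyticSolutionOn F z₀ α β V g →
    U ⊆ V → EqOn g f U → V = U

/-!
The two families of equations have the *Painlevé property*: every solution is meromorphic in the
whole plane. Granted this, a maximally extended solution has to live exactly on the complement of
the poles of its meromorphic continuation, whatever domain was used to extend it
(`IsMaximalAnalyticSolution.eq_meromorphic`), and any analytic solution with the same data, found on
any connected open set, is a restriction of it. The theorem then follows from the analytic
dependence of local solutions on initial data and parameters: the set of points near which
`(z, ε) ↦ y(z, ε)` is defined and analytic for small `ε` is open, contains `z₀`, and is relatively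
closed in the domain for `ε = 0`, because near any of its points the local flow exists for a
uniform time (`exists_radius_analytic_dependence`, `eventually_mem_and_analyticAt`). Compactness of
`K` gives the rest.

Local flows come from the implicit function theorem in `C([0,1], ℂ)ⁿ`, applied to the integral
equation of `Y' = h • G(Y)` with the complex time `h` as a parameter; this makes them jointly
analytic in time and initial value (`exists_analytic_local_flow`).

The Painlevé property is proved with an energy. For `y'' = F(z, y)` with `F = ½ ∂Q/∂y`, add to the
Hamiltonian `y'² - Q(z, y)` a correction `k y' χ(y)`, where `χ(y) = ȳ / (1 + |y|²)` replaces `1 / y`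
by a smooth bounded function. For suitable `k` the top-order terms of the derivative cancel, and the
energy `V` satisfies `|dV/dt| ≤ C (1 + |V|)` along every segment, with `C` independent of `y` and
`y'` (`painleveOne_energy_growth`, `painleveTwo_energy_growth`). Hence `V` stays bounded, by
Grönwall's inequality. Since `χ` has no singularity at the zeros of `y`, no detours around them are
needed; segments through poles are avoided, as almost all segments contain none. When `V` is
bounded, either `y` and `y'` are bounded, or `y` is large and the coordinates of the solution in a
chart at infinity, where the equation is a regular polynomial system, are bounded. In both cases
there is a meromorphic solution on a disc of a uniform radius (`painleveOne_uniform_local`,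
`painleveTwo_uniform_local`), and such discs can be glued
(`exists_meromorphic_solution_of_energy`).
-/

/-! ### Local flows of polynomial vector fields -/

/-- The integration operator `f ↦ (t ↦ ∫₀ᵗ f)` on `C([0,1], ℂ)`. -/
noncomputable def primitiveCLM : C(unitInterval, ℂ) →L[ℂ] C(unitInterval, ℂ) :=
  LinearMap.mkContinuous
    { toFun := fun f =>
        ⟨fun t => ∫ τ in (0 : ℝ)..t, f (projIcc 0 1 zero_le_one τ),
          (intervalIntegral.continuous_primitive (fun a b =>
            (f.continuous.comp continuous_projIcc).intervalIntegrable a b) 0).comp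
            continuous_subtype_val⟩
      map_add' := fun f g => by
        ext t
        exact intervalIntegral.integral_add
          ((f.continuous.comp continuous_projIcc).intervalIntegrable _ _)
          ((g.continuous.comp continuous_projIcc).intervalIntegrable _ _)
      map_smul' := fun c f => by
        ext t
        exact intervalIntegral.integral_smul c _ } 1 (fun f => by
    rw [one_mul, ContinuousMap.norm_le _ (norm_nonneg f)]
    intro t
    have h := intervalIntegral.norm_integral_le_of_norm_le_const (a := (0 : ℝ)) (b := t)
      (f := fun τ => f (projIcc 0 1 zero_le_one τ)) (C := ‖f‖) (fun τ _ => f.norm_coe_le_norm _)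
    refine h.trans ?_
    have h0 := t.2.1
    have h1 := t.2.2
    rw [sub_zero, abs_of_nonneg h0]
    exact mul_le_of_le_one_right (norm_nonneg _) h1)

lemma primitiveCLM_apply (f : C(unitInterval, ℂ)) (t : unitInterval) :
    primitiveCLM f t = ∫ τ in (0 : ℝ)..t, f (projIcc 0 1 zero_le_one τ) := rfl

/-- Primitives are compatible with the time change `t ↦ s t`. -/
lemma smul_primitiveCLM_comp_mul (s : unitInterval) (f : C(unitInterval, ℂ))
    (t : unitInterval) :
    (s : ℂ) * primitiveCLM (f.comp ⟨fun t => s * t, by fun_prop⟩) t = primitiveCLM f (s * t) := by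
  rw [primitiveCLM_apply, primitiveCLM_apply]
  have h : ∫ τ in (0 : ℝ)..t, (f.comp ⟨fun t => s * t, by fun_prop⟩ : C(unitInterval, ℂ))
      (projIcc 0 1 zero_le_one τ) =
      ∫ τ in (0 : ℝ)..t, f (projIcc 0 1 zero_le_one (s * τ)) := by
    refine intervalIntegral.integral_congr fun τ hτ => ?_
    rw [uIcc_of_le t.2.1] at hτ
    have hτ1 : τ ∈ Icc (0 : ℝ) 1 := ⟨hτ.1, hτ.2.trans t.2.2⟩
    have hs : (s : ℝ) * τ ∈ Icc (0 : ℝ) 1 := unitInterval.mul_mem s.2 hτ1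
    simp only [ContinuousMap.comp_apply, ContinuousMap.coe_mk]
    rw [projIcc_of_mem _ hτ1, projIcc_of_mem _ hs]
    rfl
  rw [h]
  have := intervalIntegral.smul_integral_comp_mul_left (a := 0) (b := (t : ℝ))
    (fun τ => f (projIcc 0 1 zero_le_one τ)) (s : ℝ)
  simpa using this

lemma hasDerivAt_primitiveCLM (f : C(unitInterval, ℂ)) {s : ℝ} (hs : s ∈ Ioo (0 : ℝ) 1) :
    HasDerivAt (fun s : ℝ => primitiveCLM f (projIcc 0 1 zero_le_one s))
      (f ⟨s, hs.1.le, hs.2.le⟩) s := by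
  have hc : Continuous fun τ => f (projIcc 0 1 zero_le_one τ) :=
    f.continuous.comp continuous_projIcc
  have h := intervalIntegral.integral_hasDerivAt_right (hc.intervalIntegrable 0 s)
    hc.aestronglyMeasurable.stronglyMeasurableAtFilter hc.continuousAt
  rw [projIcc_of_mem zero_le_one ⟨hs.1.le, hs.2.le⟩] at h
  refine h.congr_of_eventuallyEq ?_
  filter_upwards [Ioo_mem_nhds hs.1 hs.2] with u hu
  rw [primitiveCLM_apply, projIcc_of_mem zero_le_one ⟨hu.1.le, hu.2.le⟩]

lemma contDiff_aeval_mvPolynomial {σ : Type*} [Fintype σ] (q : MvPolynomial σ ℂ) :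
    ContDiff ℂ ⊤ (fun Y : σ → C(unitInterval, ℂ) => MvPolynomial.aeval Y q) := by
  induction q using MvPolynomial.induction_on with
  | C a => simpa using contDiff_const
  | add p q hp hq => simpa using hp.add hq
  | mul_X p i hp => simpa using hp.mul (contDiff_apply ℂ _ i)

lemma aeval_continuousMap_apply {σ : Type*} (q : MvPolynomial σ ℂ) (Y : σ → C(unitInterval, ℂ))
    (t : unitInterval) :
    (MvPolynomial.aeval Y q) t = MvPolynomial.eval (fun i => Y i t) q := by
  induction q using MvPolynomial.induction_on with
  | C a => simp
  | add p q hp hq => simp [hp, hq]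
  | mul_X p i hp => simp [hp]

/-- The identity minus the Picard operator, as a function of the (complex) length of the time
interval, of the initial value, and of a curve parametrized by `[0,1]`: it vanishes exactly when
the curve solves the initial value problem for `Y' = h • G(Y)`. -/
noncomputable def picardDefect {σ : Type*} (G : σ → MvPolynomial σ ℂ)
    (x : (ℂ × (σ → ℂ)) × (σ → C(unitInterval, ℂ))) : σ → C(unitInterval, ℂ) :=
  fun i => x.2 i - ContinuousLinearMap.const ℂ unitInterval (x.1.2 i)
    - x.1.1 • primitiveCLM (MvPolynomial.aeval x.2 (G i))

lemma contDiff_picardDefect {σ : Type*} [Fintype σ] (G : σ → MvPolynomial σ ℂ) : ContDiff ℂ ⊤ (picardDefect G) := by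
  rw [contDiff_pi]
  intro i
  have h1 : ContDiff ℂ ⊤ fun x : (ℂ × (σ → ℂ)) × (σ → C(unitInterval, ℂ)) =>
      MvPolynomial.aeval x.2 (G i) := (contDiff_aeval_mvPolynomial (G i)).comp contDiff_snd
  have h2 : ContDiff ℂ ⊤ fun x : (ℂ × (σ → ℂ)) × (σ → C(unitInterval, ℂ)) => x.2 i :=
    (contDiff_apply ℂ _ i).comp contDiff_snd
  have h3 : ContDiff ℂ ⊤ fun x : (ℂ × (σ → ℂ)) × (σ → C(unitInterval, ℂ)) => x.1.2 i :=
    (contDiff_apply ℂ _ i).comp (contDiff_snd.comp contDiff_fst)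
  exact (h2.sub ((ContinuousLinearMap.contDiff _).comp h3)).sub
    ((contDiff_fst.comp contDiff_fst).smul (primitiveCLM.contDiff.comp h1))

lemma const_clm_apply (a : ℂ) (t : unitInterval) :
    ContinuousLinearMap.const ℂ unitInterval a t = a := rfl

lemma picardDefect_eq_zero_iff {σ : Type*} (G : σ → MvPolynomial σ ℂ) (h : ℂ) (p : σ → ℂ)
    (Y : σ → C(unitInterval, ℂ)) :
    picardDefect G ((h, p), Y) = 0 ↔
      ∀ i t, Y i t = p i + h * primitiveCLM (MvPolynomial.aeval Y (G i)) t := by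
  constructor
  · intro H i t
    have := congrArg (fun f : C(unitInterval, ℂ) => f t) (congrFun H i)
    simp only [picardDefect, ContinuousMap.sub_apply, ContinuousMap.smul_apply, smul_eq_mul,
      Pi.zero_apply, ContinuousMap.zero_apply, const_clm_apply] at this
    linear_combination this
  · intro H
    funext i
    ext t
    simp only [picardDefect, ContinuousMap.sub_apply, ContinuousMap.smul_apply, smul_eq_mul,
      Pi.zero_apply, ContinuousMap.zero_apply, const_clm_apply]
    linear_combination H i t

/-- If `Y` solves the integral equation with time length `h`, then `t ↦ Y (s t)` solves it with
time length `s h`. -/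
lemma picardDefect_comp_mul {σ : Type*} (G : σ → MvPolynomial σ ℂ) (h : ℂ) (p : σ → ℂ)
    (Y : σ → C(unitInterval, ℂ)) (hY : picardDefect G ((h, p), Y) = 0) (s : unitInterval) :
    picardDefect G ((s * h, p), fun i => (Y i).comp ⟨fun t => s * t, by fun_prop⟩) = 0 := by
  rw [picardDefect_eq_zero_iff] at hY ⊢
  intro i t
  have : MvPolynomial.aeval (fun i => (Y i).comp ⟨fun t => s * t, by fun_prop⟩) (G i) =
      (MvPolynomial.aeval Y (G i)).comp ⟨fun t => s * t, by fun_prop⟩ := by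
    ext t
    simp [aeval_continuousMap_apply]
  rw [this]
  have h2 := smul_primitiveCLM_comp_mul s (MvPolynomial.aeval Y (G i)) t
  have h3 := hY i (s * t)
  rw [← h2] at h3
  simp only [ContinuousMap.comp_apply, ContinuousMap.coe_mk]
  rw [h3]
  ring

/-- **Local flow.** A polynomial vector field on `ℂⁿ` has near every point a flow which is jointly
analytic in the complex time and the initial value. -/
theorem exists_analytic_local_flow {σ : Type*} [Fintype σ] (G : σ → MvPolynomial σ ℂ) (p₀ : σ → ℂ) :
    ∃ δ > 0, ∃ Φ : ℂ × (σ → ℂ) → (σ → ℂ),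
      AnalyticOnNhd ℂ Φ (Metric.ball 0 δ ×ˢ Metric.ball p₀ δ) ∧
      ∀ p ∈ Metric.ball p₀ δ, Φ (0, p) = p ∧ ∀ h ∈ Metric.ball (0 : ℂ) δ,
        HasDerivAt (fun h => Φ (h, p)) (fun i => MvPolynomial.eval (Φ (h, p)) (G i)) h := by
  classical
  set c₀ : σ → C(unitInterval, ℂ) := fun i => ContinuousMap.const _ (p₀ i) with hc₀
  set u : (ℂ × (σ → ℂ)) × (σ → C(unitInterval, ℂ)) := ((0, p₀), c₀) with hu
  have hcd : ContDiffAt ℂ ⊤ (picardDefect G) u := (contDiff_picardDefect G).contDiffAt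
  have hu0 : picardDefect G u = 0 := by
    rw [hu, picardDefect_eq_zero_iff]
    intro i t
    simp [hc₀]
  have hinr : fderiv ℂ (picardDefect G) u ∘L .inr ℂ (ℂ × (σ → ℂ)) (σ → C(unitInterval, ℂ)) =
      ContinuousLinearMap.id ℂ _ := by
    have h1 : HasFDerivAt (fun Y : σ → C(unitInterval, ℂ) => ((((0 : ℂ), p₀), Y) :
        (ℂ × (σ → ℂ)) × (σ → C(unitInterval, ℂ))))
        (.inr ℂ (ℂ × (σ → ℂ)) (σ → C(unitInterval, ℂ))) c₀ := hasFDerivAt_prodMk_right _ _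
    have h2 := ((hcd.differentiableAt (by simp)).hasFDerivAt).comp c₀ h1
    have h3 : (picardDefect G ∘ fun Y : σ → C(unitInterval, ℂ) => ((((0 : ℂ), p₀), Y) :
        (ℂ × (σ → ℂ)) × (σ → C(unitInterval, ℂ)))) = fun Y => Y - c₀ := by
      funext Y i
      ext t
      simp [picardDefect, hc₀]
    rw [h3] at h2
    exact h2.unique ((hasFDerivAt_id c₀).sub_const c₀)
  have hinv : (fderiv ℂ (picardDefect G) u ∘L
      .inr ℂ (ℂ × (σ → ℂ)) (σ → C(unitInterval, ℂ))).IsInvertible := by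
    rw [hinr]; exact ⟨ContinuousLinearEquiv.refl ℂ _, rfl⟩
  set ψ := hcd.implicitFunction (by simp) hinv with hψ
  have hψcd : ContDiffAt ℂ ⊤ ψ (0, p₀) := hcd.contDiffAt_implicitFunction (by simp) hinv
  have hψself : ψ (0, p₀) = c₀ := hcd.implicitFunction_apply_self (by simp) hinv
  have hiff : ∀ᶠ v in 𝓝 u, picardDefect G v = 0 ↔ ψ v.1 = v.2 := by
    have := hcd.eventually_apply_eq_iff_implicitFunction (by simp) hinv
    rwa [hu0] at this
  obtain ⟨ρ, hρ, hball⟩ := Metric.eventually_nhds_iff_ball.1 hiff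
  have hana : ∀ᶠ x in 𝓝 ((0 : ℂ), p₀), AnalyticAt ℂ ψ x :=
    hψcd.analyticAt.eventually_analyticAt
  have hclose : ∀ᶠ x in 𝓝 ((0 : ℂ), p₀), ψ x ∈ Metric.ball c₀ ρ := by
    have := hψcd.continuousAt.eventually (Metric.ball_mem_nhds (ψ (0, p₀)) hρ)
    rwa [hψself] at this
  obtain ⟨δ₀, hδ₀, hδ⟩ := Metric.eventually_nhds_iff_ball.1 (hana.and hclose)
  -- `δ` is small enough for `ψ` to be defined at twice the time needed.
  set δ := min δ₀ ρ / 2 with hδdef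
  have hδpos : 0 < δ := by positivity
  have hδ1 : 2 * δ ≤ δ₀ := by rw [hδdef]; linarith [min_le_left δ₀ ρ]
  have hδ2 : 2 * δ ≤ ρ := by rw [hδdef]; linarith [min_le_right δ₀ ρ]
  have hmem : ∀ h ∈ Metric.ball (0 : ℂ) (2 * δ), ∀ p ∈ Metric.ball p₀ δ,
      (h, p) ∈ Metric.ball ((0 : ℂ), p₀) δ₀ ∧ (h, p) ∈ Metric.ball ((0 : ℂ), p₀) ρ := by
    intro h hh p hp
    rw [← ball_prod_same, ← ball_prod_same]
    exact ⟨⟨Metric.ball_subset_ball hδ1 hh, Metric.ball_subset_ball (by linarith) hp⟩,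
      ⟨Metric.ball_subset_ball hδ2 hh, Metric.ball_subset_ball (by linarith) hp⟩⟩
  have hzero : ∀ h ∈ Metric.ball (0 : ℂ) (2 * δ), ∀ p ∈ Metric.ball p₀ δ,
      picardDefect G ((h, p), ψ (h, p)) = 0 := by
    intro h hh p hp
    refine (hball ((h, p), ψ (h, p)) ?_).2 rfl
    rw [hu, ← ball_prod_same]
    exact ⟨(hmem h hh p hp).2, (hδ _ (hmem h hh p hp).1).2⟩
  -- The solution for the time `s h` is the solution for the time `h`, run at speed `s`.
  have hscale : ∀ h ∈ Metric.ball (0 : ℂ) (2 * δ), ∀ p ∈ Metric.ball p₀ δ, ∀ s : unitInterval,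
      ∀ i, ψ (s * h, p) i 1 = ψ (h, p) i s := by
    intro h hh p hp s i
    have h1 := picardDefect_comp_mul G h p _ (hzero h hh p hp) s
    have hsh : (s : ℂ) * h ∈ Metric.ball (0 : ℂ) (2 * δ) := by
      rw [mem_ball_zero_iff] at hh ⊢
      refine lt_of_le_of_lt ?_ hh
      rw [norm_mul, Complex.norm_real, Real.norm_of_nonneg s.2.1]
      exact mul_le_of_le_one_left (norm_nonneg _) s.2.2
    have h2 := (hball ((s * h, p), fun i => (ψ (h, p) i).comp ⟨fun t => s * t, by fun_prop⟩)
      (by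
        rw [hu, ← ball_prod_same]
        refine ⟨(hmem _ hsh p hp).2, ?_⟩
        have hc := (hδ _ (hmem h hh p hp).1).2
        rw [Metric.mem_ball] at hc ⊢
        refine lt_of_le_of_lt ?_ hc
        rw [dist_pi_le_iff dist_nonneg]
        intro j
        rw [ContinuousMap.dist_le dist_nonneg]
        intro t
        have h3 : dist (ψ (h, p) j (s * t)) (c₀ j (s * t)) ≤ dist (ψ (h, p) j) (c₀ j) :=
          ContinuousMap.dist_apply_le_dist _
        exact h3.trans (dist_le_pi_dist (ψ (h, p)) c₀ j))).1 h1
    have h3 := congrArg (fun f : C(unitInterval, ℂ) => f 1) (congrFun h2 i)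
    simpa using h3
  set Φ : ℂ × (σ → ℂ) → (σ → ℂ) := fun x i => ψ x i 1 with hΦ
  have hΦana : ∀ h ∈ Metric.ball (0 : ℂ) (2 * δ), ∀ p ∈ Metric.ball p₀ δ,
      AnalyticAt ℂ Φ (h, p) := by
    intro h hh p hp
    have h1 := (hδ _ (hmem h hh p hp).1).1
    refine (analyticAt_pi_iff (f := fun i x => ψ x i 1)).2 fun i => ?_
    have h2 : AnalyticAt ℂ (fun x => ψ x i) (h, p) :=
      (analyticAt_pi_iff (f := fun i x => ψ x i)).1 h1 i
    exact ((ContinuousMap.evalCLM ℂ (1 : unitInterval) :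
      C(unitInterval, ℂ) →L[ℂ] ℂ).analyticAt _).comp h2
  have hsub : ∀ h ∈ Metric.ball (0 : ℂ) δ, h ∈ Metric.ball (0 : ℂ) (2 * δ) := fun h hh =>
    Metric.ball_subset_ball (by linarith) hh
  have hdiff : ∀ p ∈ Metric.ball p₀ δ, ∀ h ∈ Metric.ball (0 : ℂ) δ,
      AnalyticAt ℂ (fun h => Φ (h, p)) h := by
    intro p hp h hh
    have h1 := hΦana h (hsub h hh) p hp
    exact h1.comp₂ analyticAt_id analyticAt_const
  refine ⟨δ, hδpos, Φ, fun x hx => hΦana _ (hsub _ hx.1) _ hx.2, fun p hp => ⟨?_, ?_⟩⟩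
  · funext i
    have h0 : (0 : ℂ) ∈ Metric.ball (0 : ℂ) (2 * δ) := Metric.mem_ball_self (by positivity)
    have := (picardDefect_eq_zero_iff G 0 p _).1 (hzero 0 h0 p hp) i 1
    simpa using this
  · -- For `h ≠ 0`, differentiate the integral equation for time length `2 h` at `s = 1 / 2`.
    have hne : ∀ h ∈ Metric.ball (0 : ℂ) δ, h ≠ 0 → ∀ i,
        deriv (fun h => Φ (h, p) i) h = MvPolynomial.eval (Φ (h, p)) (G i) := by
      intro h hh h0 i
      have h2h : 2 * h ∈ Metric.ball (0 : ℂ) (2 * δ) := by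
        rw [mem_ball_zero_iff] at hh ⊢
        rw [norm_mul, Complex.norm_two]; linarith
      have hhalf : (1 / 2 : ℝ) ∈ Ioo (0 : ℝ) 1 := by norm_num
      have hd1 : HasDerivAt (fun s : ℝ => Φ (s * (2 * h), p) i)
          (2 * h * MvPolynomial.eval (Φ (h, p)) (G i)) (1 / 2 : ℝ) := by
        have e1 := (hasDerivAt_primitiveCLM
          (MvPolynomial.aeval (ψ (2 * h, p)) (G i)) hhalf).const_mul (2 * h)
        have e2 := e1.const_add (p i)
        have e3 : (fun i => ψ (2 * h, p) i ⟨1 / 2, hhalf.1.le, hhalf.2.le⟩) = Φ (h, p) := by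
          funext j
          rw [← hscale _ h2h p hp]
          simp [hΦ]
        rw [aeval_continuousMap_apply, e3] at e2
        refine e2.congr_of_eventuallyEq ?_
        filter_upwards [Ioo_mem_nhds hhalf.1 hhalf.2] with s hs
        have hsI : s ∈ Icc (0 : ℝ) 1 := ⟨hs.1.le, hs.2.le⟩
        rw [projIcc_of_mem _ hsI]
        have e4 := hscale _ h2h p hp ⟨s, hsI⟩ i
        rw [(picardDefect_eq_zero_iff G (2 * h) p _).1 (hzero _ h2h p hp) i ⟨s, hsI⟩] at e4
        exact e4
      have hd2 : HasDerivAt (fun s : ℝ => Φ (s * (2 * h), p) i)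
          (deriv (fun h => Φ (h, p) i) h * (2 * h)) (1 / 2 : ℝ) := by
        have e1 : HasDerivAt (fun h => Φ (h, p) i) (deriv (fun h => Φ (h, p) i) h)
            (((1 / 2 : ℝ) : ℂ) * (2 * h)) := by
          have : (((1 / 2 : ℝ) : ℂ) * (2 * h)) = h := by push_cast; ring
          rw [this]
          have e0 := hdiff p hp h hh
          exact ((analyticAt_pi_iff (f := fun i h => Φ (h, p) i)).1 e0
            i).differentiableAt.hasDerivAt
        have e2 : HasDerivAt (fun s : ℝ => (s : ℂ) * (2 * h)) (2 * h) (1 / 2 : ℝ) := by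
          simpa using (Complex.ofRealCLM.hasDerivAt (x := (1 / 2 : ℝ))).mul_const (2 * h)
        exact e1.comp (1 / 2 : ℝ) e2
      have := hd1.unique hd2
      have h2 : 2 * h ≠ 0 := by simpa using h0
      refine mul_right_cancel₀ h2 ?_
      rw [← this]; ring
    intro h hh
    rw [hasDerivAt_pi]
    intro i
    have hi : ∀ h ∈ Metric.ball (0 : ℂ) δ, AnalyticAt ℂ (fun h => Φ (h, p) i) h := fun h hh =>
      (analyticAt_pi_iff (f := fun i h => Φ (h, p) i)).1 (hdiff p hp h hh) i
    suffices H : deriv (fun h => Φ (h, p) i) h = MvPolynomial.eval (Φ (h, p)) (G i) by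
      rw [← H]; exact (hi h hh).differentiableAt.hasDerivAt
    by_cases h0 : h = 0
    · -- At `h = 0` the equation follows by continuity.
      subst h0
      have c1 : ContinuousAt (fun h => deriv (fun h => Φ (h, p) i) h) 0 :=
        (hi 0 hh).deriv.continuousAt
      have c2 : ContinuousAt (fun h => MvPolynomial.eval (Φ (h, p)) (G i)) 0 :=
        (MvPolynomial.continuous_eval (G i)).continuousAt.comp (hdiff p hp 0 hh).continuousAt
      refine ((c1.eventuallyEq_nhds_iff_eventuallyEq_nhdsNE c2).1 ?_).eq_of_nhds
      filter_upwards [self_mem_nhdsWithin,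
        mem_nhdsWithin_of_mem_nhds (Metric.isOpen_ball.mem_nhds hh)] with h h1 h2
      exact hne h h2 h1 i
    · exact hne h hh h0 i

/-- Solutions of a polynomial system exist on discs of a common radius as long as the initial
values stay in a compact set. -/
theorem exists_uniform_local_solution {σ : Type*} [Fintype σ] (G : σ → MvPolynomial σ ℂ)
    {C : Set (σ → ℂ)} (hC : IsCompact C) :
    ∃ δ > 0, ∀ p ∈ C, ∃ X : ℂ → σ → ℂ, X 0 = p ∧ ∀ h ∈ Metric.ball (0 : ℂ) δ,
      HasDerivAt X (fun i => MvPolynomial.eval (X h) (G i)) h := by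
  refine hC.induction_on (p := fun C => ∃ δ > 0, ∀ p ∈ C, ∃ X : ℂ → σ → ℂ, X 0 = p ∧
    ∀ h ∈ Metric.ball (0 : ℂ) δ, HasDerivAt X (fun i => MvPolynomial.eval (X h) (G i)) h)
    ⟨1, one_pos, by simp⟩ ?_ ?_ ?_
  · rintro s t hst ⟨δ, hδ, H⟩
    exact ⟨δ, hδ, fun p hp => H p (hst hp)⟩
  · rintro s t ⟨δ, hδ, H⟩ ⟨δ', hδ', H'⟩
    refine ⟨min δ δ', lt_min hδ hδ', fun p hp => ?_⟩
    rcases hp with hp | hp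
    · obtain ⟨X, h0, hX⟩ := H p hp
      exact ⟨X, h0, fun h hh => hX h (Metric.ball_subset_ball (min_le_left _ _) hh)⟩
    · obtain ⟨X, h0, hX⟩ := H' p hp
      exact ⟨X, h0, fun h hh => hX h (Metric.ball_subset_ball (min_le_right _ _) hh)⟩
  · intro x _
    obtain ⟨δ, hδ, Φ, -, hΦ⟩ := exists_analytic_local_flow G x
    refine ⟨Metric.ball x δ, mem_nhdsWithin_of_mem_nhds (Metric.ball_mem_nhds x hδ), δ, hδ,
      fun p hp => ⟨fun h => Φ (h, p), hΦ p hp⟩⟩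

/-! ### Meromorphic solutions of `y'' = F(z, y)` -/

/-- Two meromorphic functions in normal form on a preconnected set which agree near one of its
points agree on the whole set. -/
lemma MeromorphicNFOn.eqOn_of_eventuallyEq {f g : ℂ → ℂ} {U : Set ℂ} (hf : MeromorphicNFOn f U)
    (hg : MeromorphicNFOn g U) (hU : IsPreconnected U) {a : ℂ} (ha : a ∈ U)
    (h : f =ᶠ[𝓝 a] g) : ∀ x ∈ U, f =ᶠ[𝓝 x] g := by
  intro x hx
  have hm : MeromorphicOn (f - g) U := fun y hy => (hf hy).meromorphicAt.sub (hg hy).meromorphicAt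
  have hx' : meromorphicOrderAt (f - g) x = ⊤ := by
    by_contra hne
    refine hm.meromorphicOrderAt_ne_top_of_isPreconnected hU hx ha hne ?_
    rw [meromorphicOrderAt_eq_top_iff]
    filter_upwards [h.filter_mono nhdsWithin_le_nhds] with y hy
    simp [hy]
  rw [meromorphicOrderAt_eq_top_iff] at hx'
  refine ((hf hx).eventuallyEq_nhdsNE_iff_eventuallyEq_nhds (hg hx)).1 ?_
  filter_upwards [hx'] with y hy
  simpa [sub_eq_zero] using hy

lemma hasDerivAt_segment (a b : ℂ) (t : ℝ) :
    HasDerivAt (fun t : ℝ => a + t * (b - a)) (b - a) t := by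
  have h : HasDerivAt (fun t : ℝ => (t : ℂ) * (b - a)) (1 * (b - a)) t :=
    (Complex.ofRealCLM.hasDerivAt (x := t)).mul_const (b - a)
  rw [one_mul] at h
  exact h.const_add a

/-- Local uniqueness for the initial value problem of `y'' = F(z, y)`. -/
lemma eventuallyEq_of_ode {F : ℂ → ℂ → ℂ} (hF : ContDiff ℂ 1 (Function.uncurry F))
    {f g : ℂ → ℂ} {a : ℂ} (hf : AnalyticAt ℂ f a) (hg : AnalyticAt ℂ g a)
    (hfode : ∀ᶠ z in 𝓝 a, deriv (deriv f) z = F z (f z))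
    (hgode : ∀ᶠ z in 𝓝 a, deriv (deriv g) z = F z (g z))
    (h0 : f a = g a) (h1 : deriv f a = deriv g a) : f =ᶠ[𝓝 a] g := by
  set V : ℂ × ℂ × ℂ → ℂ × ℂ × ℂ := fun x => (1, x.2.2, F x.1 x.2.1) with hV
  have hVc : ContDiff ℂ 1 V := by
    have : ContDiff ℂ 1 fun x : ℂ × ℂ × ℂ => F x.1 x.2.1 :=
      hF.comp (contDiff_fst.prodMk (contDiff_fst.comp contDiff_snd))
    exact contDiff_const.prodMk ((contDiff_snd.comp contDiff_snd).prodMk this)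
  obtain ⟨K, s, hs, hK⟩ :=
    (hVc.contDiffAt (x := (a, f a, deriv f a))).exists_lipschitzOnWith
  have key : ∀ {u : ℂ → ℂ}, AnalyticAt ℂ u a →
      (∀ᶠ z in 𝓝 a, deriv (deriv u) z = F z (u z)) → u a = f a → deriv u a = deriv f a →
      ∀ᶠ z in 𝓝 a, (z, u z, deriv u z) ∈ s ∧
        HasDerivAt (fun z => (z, u z, deriv u z)) (V (z, u z, deriv u z)) z := by
    intro u hu hode e0 e1
    have hcont : ContinuousAt (fun z => (z, u z, deriv u z)) a :=
      continuousAt_id.prodMk (hu.continuousAt.prodMk hu.deriv.continuousAt)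
    have hs' : s ∈ 𝓝 (a, u a, deriv u a) := by rwa [e0, e1]
    filter_upwards [hcont hs', hode, hu.eventually_analyticAt] with z hz1 hz2 hz3
    refine ⟨hz1, (hasDerivAt_id z).prodMk (hz3.differentiableAt.hasDerivAt.prodMk ?_)⟩
    rw [← hz2]
    exact hz3.deriv.differentiableAt.hasDerivAt
  obtain ⟨r, hr, H⟩ := Metric.eventually_nhds_iff_ball.1
    ((key hf hfode rfl rfl).and (key hg hgode h0.symm h1.symm))
  filter_upwards [Metric.ball_mem_nhds a hr] with z hz
  -- Compare the two solutions along the segment from `a` to `z`.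
  set γ : ℝ → ℂ := fun t => a + t * (z - a) with hγ
  have hγmem : ∀ t ∈ Icc (0 : ℝ) 1, γ t ∈ Metric.ball a r := by
    intro t ht
    rw [Metric.mem_ball, dist_eq_norm] at hz ⊢
    refine lt_of_le_of_lt ?_ hz
    simp only [hγ, add_sub_cancel_left, norm_mul, Complex.norm_real, Real.norm_of_nonneg ht.1]
    exact mul_le_of_le_one_left (norm_nonneg _) ht.2
  have hγd : ∀ t, HasDerivAt γ (z - a) t := by
    exact hasDerivAt_segment a z
  have hcurve : ∀ {u : ℂ → ℂ} {t : ℝ}, HasDerivAt (fun z => (z, u z, deriv u z))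
      (V (γ t, u (γ t), deriv u (γ t))) (γ t) →
      HasDerivAt (fun t => (γ t, u (γ t), deriv u (γ t)))
        ((z - a) • V (γ t, u (γ t), deriv u (γ t))) t := by
    intro u t h
    exact h.scomp t (hγd t)
  have := ODE_solution_unique_of_mem_Icc_right (a := 0) (b := 1)
    (v := fun _ x => (z - a) • V x) (s := fun _ => s) (K := ‖z - a‖₊ * K)
    (f := fun t => (γ t, f (γ t), deriv f (γ t))) (g := fun t => (γ t, g (γ t), deriv g (γ t)))
    (fun t _ => (lipschitzWith_smul (z - a)).comp_lipschitzOnWith hK)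
    (fun t ht => (hcurve (H _ (hγmem t ht)).1.2).continuousAt.continuousWithinAt)
    (fun t ht => (hcurve (H _ (hγmem t ⟨ht.1, ht.2.le⟩)).1.2).hasDerivWithinAt)
    (fun t ht => (H _ (hγmem t ⟨ht.1, ht.2.le⟩)).1.1)
    (fun t ht => (hcurve (H _ (hγmem t ht)).2.2).continuousAt.continuousWithinAt)
    (fun t ht => (hcurve (H _ (hγmem t ⟨ht.1, ht.2.le⟩)).2.2).hasDerivWithinAt)
    (fun t ht => (H _ (hγmem t ⟨ht.1, ht.2.le⟩)).2.1)
    (by simp [hγ, h0, h1])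
  have h2 := this (right_mem_Icc.2 zero_le_one)
  simp only [hγ, Complex.ofReal_one, one_mul, add_sub_cancel, Prod.mk.injEq] at h2
  exact h2.2.1

/-- `f` is a meromorphic solution of `y'' = F(z, y)` on `B`. Meromorphic functions are taken in
normal form, that is without removable singularities and with value `0` at the poles, so that they
are determined by their germ at one point. -/
structure IsMeromorphicSolutionOn (F : ℂ → ℂ → ℂ) (B : Set ℂ) (f : ℂ → ℂ) : Prop where
  nf : MeromorphicNFOn f B
  ode : ∀ z ∈ B, AnalyticAt ℂ f z → deriv (deriv f) z = F z (f z)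

namespace IsMeromorphicSolutionOn

variable {F : ℂ → ℂ → ℂ} {B B' : Set ℂ} {f g : ℂ → ℂ}

lemma mono (hf : IsMeromorphicSolutionOn F B f) (h : B' ⊆ B) : IsMeromorphicSolutionOn F B' f :=
  ⟨fun _ hz => hf.nf (h hz), fun z hz => hf.ode z (h hz)⟩

/-- Being a meromorphic solution is a local property. -/
lemma of_locally (h : ∀ z ∈ B, ∃ f : ℂ → ℂ, IsMeromorphicSolutionOn F {z} f ∧ g =ᶠ[𝓝 z] f) :
    IsMeromorphicSolutionOn F B g := by
  refine ⟨fun z hz => ?_, fun z hz ha => ?_⟩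
  · obtain ⟨f, hf, he⟩ := h z hz
    exact (meromorphicNFAt_congr he).2 (hf.nf rfl)
  · obtain ⟨f, hf, he⟩ := h z hz
    rw [he.deriv.deriv_eq, he.eq_of_nhds]
    exact hf.ode z rfl (ha.congr he)

lemma eventually_ode (hf : IsMeromorphicSolutionOn F B f) (hB : IsOpen B) {a : ℂ} (ha : a ∈ B)
    (han : AnalyticAt ℂ f a) : ∀ᶠ z in 𝓝 a, deriv (deriv f) z = F z (f z) := by
  filter_upwards [hB.mem_nhds ha, han.eventually_analyticAt] with z h1 h2
  exact hf.ode z h1 h2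

/-- A meromorphic function which satisfies the equation in punctured neighbourhoods becomes a
meromorphic solution after passing to the normal form. -/
lemma toMeromorphicNFOn (hf : MeromorphicOn f B) (hFc : Continuous (Function.uncurry F))
    (h : ∀ z ∈ B, ∀ᶠ x in 𝓝[≠] z, deriv (deriv f) x = F x (f x)) :
    IsMeromorphicSolutionOn F B (toMeromorphicNFOn f B) := by
  refine ⟨meromorphicNFOn_toMeromorphicNFOn f B, fun z hz ha => ?_⟩
  have he := hf.toMeromorphicNFOn_eq_self_on_nhdsNE hz
  have c1 : ContinuousAt (deriv (deriv (_root_.toMeromorphicNFOn f B))) z :=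
    ha.deriv.deriv.continuousAt
  have c2 : ContinuousAt (fun x => F x (_root_.toMeromorphicNFOn f B x)) z :=
    hFc.continuousAt.comp (f := fun x => (x, _root_.toMeromorphicNFOn f B x))
      (continuousAt_id.prodMk ha.continuousAt)
  refine ((c1.eventuallyEq_nhds_iff_eventuallyEq_nhdsNE c2).1 ?_).eq_of_nhds
  filter_upwards [h z hz, eventually_eventually_nhdsWithin.2 he, self_mem_nhdsWithin] with x h1 h2 h3
  have h4 : _root_.toMeromorphicNFOn f B =ᶠ[𝓝 x] f := by
    rwa [IsOpen.nhdsWithin_eq isOpen_compl_singleton h3] at h2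
  rw [h4.deriv.deriv_eq, h4.eq_of_nhds, h1]

/-- Meromorphic solutions with the same initial data at a regular point agree. -/
lemma eventuallyEq (hf : IsMeromorphicSolutionOn F B f) (hg : IsMeromorphicSolutionOn F B g)
    (hF : ContDiff ℂ 1 (Function.uncurry F)) (hB : IsOpen B) (hBc : IsPreconnected B) {a : ℂ}
    (ha : a ∈ B) (hfa : AnalyticAt ℂ f a) (hga : AnalyticAt ℂ g a) (h0 : f a = g a)
    (h1 : deriv f a = deriv g a) : ∀ x ∈ B, f =ᶠ[𝓝 x] g :=
  hf.nf.eqOn_of_eventuallyEq hg.nf hBc ha (eventuallyEq_of_ode hF hfa hga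
    (hf.eventually_ode hB ha hfa) (hg.eventually_ode hB ha hga) h0 h1)

end IsMeromorphicSolutionOn

/-- An analytic solution is a meromorphic one. -/
lemma isMeromorphicSolutionOn_of_analyticOnNhd {F : ℂ → ℂ → ℂ} {B : Set ℂ} {f : ℂ → ℂ}
    (hf : AnalyticOnNhd ℂ f B) (hode : ∀ z ∈ B, deriv (deriv f) z = F z (f z)) :
    IsMeromorphicSolutionOn F B f :=
  ⟨hf.meromorphicNFOn, fun z hz _ => hode z hz⟩

/-! ### Meromorphic continuation to the whole plane -/

/-- In a disc, the points which can be joined to the centre by a segment avoiding a given countable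
set are dense. -/
lemma exists_segment_avoiding_countable {S : Set ℂ} (hS : S.Countable) {z₀ : ℂ} (hz₀ : z₀ ∉ S)
    {O : Set ℂ} (hO : IsOpen O) (hne : O.Nonempty) :
    ∃ z ∈ O, ∀ t ∈ Icc (0 : ℝ) 1, z₀ + t * (z - z₀) ∉ S := by
  have hcount : Countable S := hS.to_subtype
  have hnull : ∀ p : S, ∀ᵐ z : ℂ, z ∉ (AffineSubspace.mk' z₀ (ℝ ∙ ((p : ℂ) - z₀)) : Set ℂ) := by
    intro p
    refine MeasureTheory.measure_eq_zero_iff_ae_notMem.1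
      (MeasureTheory.Measure.addHaar_affineSubspace MeasureTheory.volume _ fun htop => ?_)
    have h1 := congrArg AffineSubspace.direction htop
    rw [AffineSubspace.direction_mk', AffineSubspace.direction_top] at h1
    have h2 := finrank_span_le_card (R := ℝ) ({(p : ℂ) - z₀} : Set ℂ)
    rw [h1, finrank_top, Complex.finrank_real_complex] at h2
    simp at h2
  have hd := MeasureTheory.Measure.dense_of_ae (MeasureTheory.ae_all_iff.2 hnull)
  obtain ⟨z, hzO, hz⟩ := hd.inter_open_nonempty O hO hne
  refine ⟨z, hzO, fun t ht hmem => ?_⟩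
  have ht0 : t ≠ 0 := by
    rintro rfl
    simp at hmem
    exact hz₀ hmem
  refine hz ⟨_, hmem⟩ ?_
  simp only [SetLike.mem_coe, AffineSubspace.mem_mk', vsub_eq_sub, add_sub_cancel_left]
  rw [Submodule.mem_span_singleton]
  refine ⟨t⁻¹, ?_⟩
  rw [Complex.real_smul, ← mul_assoc, ← Complex.ofReal_mul, inv_mul_cancel₀ ht0]
  simp

/-- **Continuation step.** If a meromorphic solution on a disc can be re-expanded at a dense set of
points of this disc in discs of a fixed radius `δ`, then it extends to a larger disc. -/
lemma IsMeromorphicSolutionOn.extend_ball {F : ℂ → ℂ → ℂ}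
    (hF : ContDiff ℂ 1 (Function.uncurry F)) {z₀ : ℂ} {r δ : ℝ} (hr : 0 < r) (hδ : 0 < δ)
    {f : ℂ → ℂ} (hf : IsMeromorphicSolutionOn F (Metric.ball z₀ r) f) (hfa : AnalyticAt ℂ f z₀)
    (hext : ∀ a ∈ Metric.ball z₀ r,
      (∀ t ∈ Icc (0 : ℝ) 1, z₀ + t * (a - z₀) ∈ Metric.ball z₀ r ∧
        AnalyticAt ℂ f (z₀ + t * (a - z₀))) →
      ∃ g, IsMeromorphicSolutionOn F (Metric.ball a δ) g ∧ AnalyticAt ℂ g a ∧ g a = f a ∧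
        deriv g a = deriv f a) :
    ∃ g, IsMeromorphicSolutionOn F (Metric.ball z₀ (r + δ / 2)) g ∧ g =ᶠ[𝓝 z₀] f := by
  classical
  set D : Set ℂ := {a | a ∈ Metric.ball z₀ r ∧ ∀ t ∈ Icc (0 : ℝ) 1,
    z₀ + t * (a - z₀) ∈ Metric.ball z₀ r ∧ AnalyticAt ℂ f (z₀ + t * (a - z₀))} with hD
  have hex : ∀ a : D, ∃ g, IsMeromorphicSolutionOn F (Metric.ball (a : ℂ) δ) g ∧
      AnalyticAt ℂ g a ∧ g a = f a ∧ deriv g a = deriv f a := fun a => hext a a.2.1 a.2.2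
  choose g hg hga hg0 hg1 using hex
  -- every local expansion agrees with `f` where both are defined
  have hgf : ∀ a : D, ∀ x ∈ Metric.ball (a : ℂ) δ ∩ Metric.ball z₀ r, g a =ᶠ[𝓝 x] f := by
    intro a
    have hfa' : AnalyticAt ℂ f a := by
      have := (a.2.2 1 (by simp)).2
      simpa using this
    exact ((hg a).mono inter_subset_left).eventuallyEq (hf.mono inter_subset_right) hF
      (Metric.isOpen_ball.inter Metric.isOpen_ball)
      ((convex_ball _ _).inter (convex_ball _ _)).isPreconnected
      ⟨Metric.mem_ball_self hδ, a.2.1⟩ (hga a) hfa' (hg0 a) (hg1 a)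
  -- two local expansions agree near the midpoint of their centres, hence wherever both are defined
  have hgg : ∀ a b : D, ∀ x ∈ Metric.ball (a : ℂ) δ ∩ Metric.ball (b : ℂ) δ,
      g a =ᶠ[𝓝 x] g b := by
    intro a b x hx
    have hab : dist (a : ℂ) b < 2 * δ := by
      have h1 := hx.1
      have h2 := hx.2
      rw [Metric.mem_ball] at h1 h2
      linarith [dist_triangle_left (a : ℂ) b x]
    set m := midpoint ℝ (a : ℂ) b with hm
    have hma : m ∈ Metric.ball (a : ℂ) δ := by
      rw [Metric.mem_ball, hm, dist_midpoint_left]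
      norm_num
      linarith
    have hmb : m ∈ Metric.ball (b : ℂ) δ := by
      rw [Metric.mem_ball, hm, dist_midpoint_right]
      norm_num
      linarith
    have hmr : m ∈ Metric.ball z₀ r := (convex_ball z₀ r).midpoint_mem a.2.1 b.2.1
    exact ((hg a).mono inter_subset_left).nf.eqOn_of_eventuallyEq
      ((hg b).mono inter_subset_right).nf
      ((convex_ball _ _).inter (convex_ball _ _)).isPreconnected ⟨hma, hmb⟩
      ((hgf a m ⟨hma, hmr⟩).trans (hgf b m ⟨hmb, hmr⟩).symm) x hx
  have hcover : ∀ z ∈ Metric.ball z₀ (r + δ / 2), ∃ a : D, z ∈ Metric.ball (a : ℂ) δ := by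
    intro z hz
    set c : ℝ := r / (r + δ / 2) with hc
    have hpos : 0 < r + δ / 2 := by positivity
    have hc0 : 0 < c := by positivity
    have hc1 : 1 - c = (δ / 2) / (r + δ / 2) := by rw [hc]; field_simp; ring
    have hzn : ‖z - z₀‖ < r + δ / 2 := by rwa [Metric.mem_ball, dist_eq_norm] at hz
    set w : ℂ := z₀ + c * (z - z₀) with hw
    have hwr : w ∈ Metric.ball z₀ r := by
      rw [Metric.mem_ball, dist_eq_norm, hw, add_sub_cancel_left, norm_mul, Complex.norm_real,
        Real.norm_of_nonneg hc0.le]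
      calc c * ‖z - z₀‖ < c * (r + δ / 2) := by gcongr
        _ = r := by rw [hc]; field_simp
    have hwz : w ∈ Metric.ball z δ := by
      have h1 : w - z = ((-(1 - c) : ℝ) : ℂ) * (z - z₀) := by rw [hw]; push_cast; ring
      have h2 : 0 < 1 - c := by rw [hc1]; positivity
      rw [Metric.mem_ball, dist_eq_norm, h1, norm_mul, Complex.norm_real, norm_neg,
        Real.norm_of_nonneg h2.le]
      calc (1 - c) * ‖z - z₀‖ < (1 - c) * (r + δ / 2) := by gcongr
        _ = δ / 2 := by rw [hc1]; field_simp
        _ < δ := by linarith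
    obtain ⟨a, ha, hseg⟩ := exists_segment_avoiding_countable
      (S := {z | AnalyticAt ℂ f z}ᶜ ∩ Metric.ball z₀ r)
      (MeromorphicOn.countable_compl_analyticAt_inter fun y hy => (hf.nf hy).meromorphicAt)
      (z₀ := z₀) (fun h => h.1 hfa) (Metric.isOpen_ball.inter Metric.isOpen_ball)
      ⟨w, hwr, hwz⟩
    refine ⟨⟨a, ha.1, fun t ht => ?_⟩, ?_⟩
    · have hmem : z₀ + t * (a - z₀) ∈ Metric.ball z₀ r := by
        have h1 := ha.1
        rw [Metric.mem_ball, dist_eq_norm] at h1 ⊢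
        refine lt_of_le_of_lt ?_ h1
        rw [add_sub_cancel_left, norm_mul, Complex.norm_real, Real.norm_of_nonneg ht.1]
        exact mul_le_of_le_one_left (norm_nonneg _) ht.2
      exact ⟨hmem, by_contra fun h => hseg t ht ⟨h, hmem⟩⟩
    · rw [Metric.mem_ball, dist_comm]
      exact ha.2
  have hz₀D : z₀ ∈ D := by
    refine ⟨Metric.mem_ball_self hr, fun t _ => ?_⟩
    simp [hr, hfa]
  have : Nonempty D := ⟨⟨z₀, hz₀D⟩⟩
  choose! a ha using hcover
  set G : ℂ → ℂ := fun z => g (a z) z with hG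
  have hGg : ∀ z ∈ Metric.ball z₀ (r + δ / 2), ∀ b : D, z ∈ Metric.ball (b : ℂ) δ →
      G =ᶠ[𝓝 z] g b := by
    intro z hz b hb
    filter_upwards [Metric.isOpen_ball.mem_nhds hz, Metric.isOpen_ball.mem_nhds hb] with x h1 h2
    exact (hgg (a x) b x ⟨ha x h1, h2⟩).eq_of_nhds
  refine ⟨G, .of_locally fun z hz => ⟨g (a z), (hg (a z)).mono ?_, hGg z hz _ (ha z hz)⟩, ?_⟩
  · exact singleton_subset_iff.2 (ha z hz)
  · exact (hGg z₀ (Metric.mem_ball_self (by positivity)) ⟨z₀, hz₀D⟩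
      (Metric.mem_ball_self hδ)).trans
      (hgf ⟨z₀, hz₀D⟩ z₀ ⟨Metric.mem_ball_self hδ, Metric.mem_ball_self hr⟩)

/-- **Continuation principle.** Suppose that `E(z, y, y')` stays bounded along every solution
continued analytically along a segment from `z₀` of bounded length, and that initial data with
bounded `z` and bounded `E` have meromorphic solutions on discs of a uniform radius. Then the
solution of the initial value problem at `z₀` is meromorphic in the whole plane. -/
theorem exists_meromorphic_solution_of_energy {F : ℂ → ℂ → ℂ}
    (hF : ContDiff ℂ 1 (Function.uncurry F)) (z₀ α β : ℂ) (E : ℂ → ℂ → ℂ → ℂ)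
    (henergy : ∀ R : ℝ, ∃ M : ℝ, ∀ a f, ‖a - z₀‖ ≤ R → f z₀ = α → deriv f z₀ = β →
      (∀ t ∈ Icc (0 : ℝ) 1, AnalyticAt ℂ f (z₀ + t * (a - z₀)) ∧
        deriv (deriv f) (z₀ + t * (a - z₀)) = F (z₀ + t * (a - z₀)) (f (z₀ + t * (a - z₀)))) →
      ‖E a (f a) (deriv f a)‖ ≤ M)
    (hlocal : ∀ R M : ℝ, ∃ δ > 0, ∀ a w v, ‖a‖ ≤ R → ‖E a w v‖ ≤ M →
      ∃ g, IsMeromorphicSolutionOn F (Metric.ball a δ) g ∧ AnalyticAt ℂ g a ∧ g a = w ∧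
        deriv g a = v) :
    ∃ Y, IsMeromorphicSolutionOn F univ Y ∧ AnalyticAt ℂ Y z₀ ∧ Y z₀ = α ∧ deriv Y z₀ = β := by
  set P : ℝ → Prop := fun r => ∃ f, IsMeromorphicSolutionOn F (Metric.ball z₀ r) f ∧
    AnalyticAt ℂ f z₀ ∧ f z₀ = α ∧ deriv f z₀ = β with hP
  have hmono : ∀ {r s : ℝ}, s ≤ r → P r → P s := by
    rintro r s hsr ⟨f, hf, h⟩
    exact ⟨f, hf.mono (Metric.ball_subset_ball hsr), h⟩
  obtain ⟨r₀, hr₀, hloc⟩ := hlocal ‖z₀‖ ‖E z₀ α β‖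
  have hPr₀ : P r₀ := hloc z₀ α β le_rfl le_rfl
  have hPall : ∀ R : ℝ, P R := by
    intro R
    obtain ⟨M, hM⟩ := henergy R
    obtain ⟨δ, hδ, hl⟩ := hlocal (‖z₀‖ + R) M
    have hstep : ∀ r, 0 < r → r ≤ R → P r → P (r + δ / 2) := by
      rintro r hr hrR ⟨f, hf, hfa, h0, h1⟩
      obtain ⟨g, hg, hgf⟩ := hf.extend_ball hF hr hδ hfa (fun a ha hseg => by
        have haR : ‖a - z₀‖ ≤ R := by
          rw [Metric.mem_ball, dist_eq_norm] at ha
          exact ha.le.trans hrR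
        refine hl a (f a) (deriv f a) ?_
          (hM a f haR h0 h1 fun t ht => ⟨(hseg t ht).2, hf.ode _ (hseg t ht).1 (hseg t ht).2⟩)
        have := norm_add_le z₀ (a - z₀)
        rw [add_sub_cancel] at this
        linarith)
      exact ⟨g, hg, hfa.congr hgf.symm, by rw [hgf.eq_of_nhds, h0], by rw [hgf.deriv_eq, h1]⟩
    rcases le_or_gt R r₀ with hR | hR
    · exact hmono hR hPr₀
    have hn : ∀ n : ℕ, P (min (r₀ + n * (δ / 2)) R) := by
      intro n
      induction n with
      | zero => exact hmono (by simp) hPr₀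
      | succ n ih =>
        refine hmono ?_ (hstep _ (lt_min (by positivity) (hr₀.trans hR)) (min_le_right _ _) ih)
        rw [← min_add_add_right]
        push_cast
        refine min_le_min (by linarith) (by linarith)
    obtain ⟨n, hn'⟩ := exists_nat_gt ((R - r₀) / (δ / 2))
    rw [div_lt_iff₀ (by positivity)] at hn'
    have := hn n
    rwa [min_eq_right (by linarith)] at this
  choose f hf hfa hf0 hf1 using fun n : ℕ => hPall (n + 1 : ℝ)
  have hcompat : ∀ m n : ℕ, ∀ z, dist z z₀ < m + 1 → dist z z₀ < n + 1 → f m =ᶠ[𝓝 z] f n := by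
    intro m n z hm hn
    have hpos : 0 < min (m : ℝ) n + 1 := by positivity
    refine ((hf m).mono (Metric.ball_subset_ball (by simp))).eventuallyEq
      (B := Metric.ball z₀ (min (m : ℝ) n + 1))
      ((hf n).mono (Metric.ball_subset_ball (by simp))) hF Metric.isOpen_ball
      (convex_ball _ _).isPreconnected (Metric.mem_ball_self hpos) (hfa m) (hfa n)
      (by rw [hf0, hf0]) (by rw [hf1, hf1]) z ?_
    rw [Metric.mem_ball, ← min_add_add_right]
    exact lt_min hm hn
  set Y : ℂ → ℂ := fun z => f ⌈dist z z₀⌉₊ z with hY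
  have hYf : ∀ z, ∀ n : ℕ, dist z z₀ < n + 1 → Y =ᶠ[𝓝 z] f n := by
    intro z n hn
    filter_upwards [Metric.isOpen_ball.mem_nhds (show z ∈ Metric.ball z₀ (n + 1) from hn)]
      with x hx
    exact (hcompat _ n x (by linarith [Nat.le_ceil (dist x z₀)]) hx).eq_of_nhds
  have h0 := hYf z₀ 0 (by simp)
  refine ⟨Y, .of_locally fun z _ => ?_, (hfa 0).congr h0.symm, by rw [h0.eq_of_nhds, hf0],
    by rw [h0.deriv_eq, hf1]⟩
  have hz : dist z z₀ < (⌈dist z z₀⌉₊ : ℝ) + 1 := by linarith [Nat.le_ceil (dist z z₀)]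
  exact ⟨_, (hf _).mono (singleton_subset_iff.2 hz), hYf z _ hz⟩

/-! ### The energy -/

open ComplexConjugate in
/-- The function `1 / (1 + |w|²)`. -/
noncomputable def cutoff (w : ℂ) : ℂ := (1 + w * conj w)⁻¹

open ComplexConjugate in
/-- The function `w̄ / (1 + |w|²)`: a bounded smooth substitute for `1 / w`, which it approximates
near infinity. -/
noncomputable def smoothInv (w : ℂ) : ℂ := conj w * cutoff w

open ComplexConjugate in
lemma one_add_mul_conj (w : ℂ) : 1 + w * conj w = ((1 + ‖w‖ ^ 2 : ℝ) : ℂ) := by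
  rw [Complex.mul_conj, Complex.normSq_eq_norm_sq]
  push_cast
  rfl

open ComplexConjugate in
lemma one_add_mul_conj_ne_zero (w : ℂ) : 1 + w * conj w ≠ 0 := by
  rw [one_add_mul_conj]
  exact_mod_cast (by positivity : (1 + ‖w‖ ^ 2 : ℝ) ≠ 0)

lemma mul_smoothInv (w : ℂ) : w * smoothInv w = 1 - cutoff w := by
  have h := one_add_mul_conj_ne_zero w
  rw [smoothInv, cutoff]
  field_simp
  ring

lemma norm_cutoff (w : ℂ) : ‖cutoff w‖ = (1 + ‖w‖ ^ 2)⁻¹ := by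
  rw [cutoff, one_add_mul_conj, norm_inv, Complex.norm_real, Real.norm_of_nonneg (by positivity)]

lemma norm_smoothInv (w : ℂ) : ‖smoothInv w‖ = ‖w‖ * ‖cutoff w‖ := by
  rw [smoothInv, norm_mul, RCLike.norm_conj]

lemma norm_cutoff_mul (w : ℂ) : ‖cutoff w‖ * (1 + ‖w‖ ^ 2) = 1 := by
  rw [norm_cutoff]
  exact inv_mul_cancel₀ (by positivity)

lemma norm_cutoff_le_one (w : ℂ) : ‖cutoff w‖ ≤ 1 := by
  nlinarith [norm_cutoff_mul w, norm_nonneg (cutoff w), sq_nonneg ‖w‖,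
    mul_nonneg (norm_nonneg (cutoff w)) (sq_nonneg ‖w‖)]

lemma sq_norm_mul_norm_cutoff_le_one (w : ℂ) : ‖w‖ ^ 2 * ‖cutoff w‖ ≤ 1 := by
  nlinarith [norm_cutoff_mul w, norm_nonneg (cutoff w)]

lemma norm_mul_norm_cutoff_le_one (w : ℂ) : ‖w‖ * ‖cutoff w‖ ≤ 1 := by
  nlinarith [norm_cutoff_mul w, norm_nonneg (cutoff w), mul_nonneg (norm_nonneg (cutoff w))
    (sq_nonneg (‖w‖ - 1))]

lemma norm_smoothInv_le_one (w : ℂ) : ‖smoothInv w‖ ≤ 1 := by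
  rw [norm_smoothInv]
  exact norm_mul_norm_cutoff_le_one w

lemma norm_one_sub_cutoff_le_one (w : ℂ) : ‖1 - cutoff w‖ ≤ 1 := by
  rw [← mul_smoothInv, norm_mul, norm_smoothInv]
  nlinarith [sq_norm_mul_norm_cutoff_le_one w]

/-- `|χ(w)³ v|` is controlled by `|v|² / (1 + |w|²)²`, for `χ = smoothInv`. -/
lemma norm_smoothInv_pow_three_mul_le (w v : ℂ) :
    ‖smoothInv w ^ 3 * v‖ ≤ 1 + ‖cutoff w‖ ^ 2 * ‖v‖ ^ 2 := by
  rw [norm_mul, norm_pow, norm_smoothInv]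
  have h1 := sq_norm_mul_norm_cutoff_le_one w
  have h2 := norm_mul_norm_cutoff_le_one w
  have h3 : 0 ≤ ‖cutoff w‖ * ‖v‖ := by positivity
  calc (‖w‖ * ‖cutoff w‖) ^ 3 * ‖v‖
      = (‖w‖ ^ 2 * ‖cutoff w‖) * (‖w‖ * ‖cutoff w‖) * (‖cutoff w‖ * ‖v‖) := by ring
    _ ≤ 1 * 1 * (‖cutoff w‖ * ‖v‖) := by gcongr
    _ ≤ 1 + ‖cutoff w‖ ^ 2 * ‖v‖ ^ 2 := by nlinarith [sq_nonneg (‖cutoff w‖ * ‖v‖ - 1)]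

open ComplexConjugate in
lemma hasDerivAt_smoothInv_comp {g : ℝ → ℂ} {g' : ℂ} {t : ℝ} (hg : HasDerivAt g g' t) :
    HasDerivAt (fun t => smoothInv (g t))
      (cutoff (g t) ^ 2 * conj g' - smoothInv (g t) ^ 2 * g') t := by
  have hc : HasDerivAt (fun t => conj (g t)) (conj g') t := hg.star
  have h1 := (hg.mul hc).const_add 1
  have h2 := hc.mul (h1.inv (one_add_mul_conj_ne_zero (g t)))
  refine h2.congr_deriv ?_
  have h := one_add_mul_conj_ne_zero (g t)
  simp only [smoothInv, cutoff, Pi.mul_apply, Pi.inv_apply]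
  field_simp
  ring

/-- The energy `v² + k χ(w) v - Q(z, w)`, where `χ(w) = w̄ / (1 + |w|²)`. For `Q` with
`∂Q/∂w = 2 F` it differs from the Hamiltonian `v² - Q` of `y'' = F(z, y)`, `v = y'`, by the
correction `k v / w`, smoothly cut off at the zeros of `w`. -/
noncomputable def energy (k : ℂ) (Q : ℂ → ℂ → ℂ) (z w v : ℂ) : ℂ :=
  v ^ 2 + k * smoothInv w * v - Q z w

open ComplexConjugate in
/-- The energy along a solution above a segment. The hypothesis `hQ` is the chain rule for
`z ↦ Q z (f z)` when `Qz` is the partial derivative of `Q` in `z` and `∂Q/∂w = 2 F`. The derivative is not complex linear in the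
direction `b - a` of the segment, since the energy is not holomorphic. -/
lemma hasDerivAt_energy {F Q Qz : ℂ → ℂ → ℂ} (k : ℂ)
    (hQ : ∀ (f : ℂ → ℂ) (z : ℂ), DifferentiableAt ℂ f z →
      HasDerivAt (fun z => Q z (f z)) (Qz z (f z) + 2 * F z (f z) * deriv f z) z)
    {a b : ℂ} {f : ℂ → ℂ} {t : ℝ} (hf : AnalyticAt ℂ f (a + t * (b - a)))
    (hode : deriv (deriv f) (a + t * (b - a)) = F (a + t * (b - a)) (f (a + t * (b - a)))) :
    HasDerivAt (fun t : ℝ => energy k Q (a + t * (b - a)) (f (a + t * (b - a)))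
        (deriv f (a + t * (b - a))))
      ((b - a) * (-Qz (a + t * (b - a)) (f (a + t * (b - a))) +
          k * smoothInv (f (a + t * (b - a))) * F (a + t * (b - a)) (f (a + t * (b - a))) -
          k * smoothInv (f (a + t * (b - a))) ^ 2 * deriv f (a + t * (b - a)) ^ 2) +
        k * cutoff (f (a + t * (b - a))) ^ 2 * deriv f (a + t * (b - a)) *
          conj (deriv f (a + t * (b - a)) * (b - a))) t := by
  have hγ := hasDerivAt_segment a b t
  have hw := hf.differentiableAt.hasDerivAt.comp t hγ
  have hv := hf.deriv.differentiableAt.hasDerivAt.comp t hγ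
  have hq := (hQ f _ hf.differentiableAt).comp t hγ
  have h := ((hv.pow 2).add (((hasDerivAt_smoothInv_comp hw).const_mul k).mul hv)).sub hq
  refine h.congr_deriv ?_
  simp only [Function.comp_apply, hode]
  push_cast
  ring

/-- A differential inequality for the energy bounds it along solutions above segments. -/
lemma energy_bounded {F Q Qz : ℂ → ℂ → ℂ} (k : ℂ)
    (hQ : ∀ (f : ℂ → ℂ) (z : ℂ), DifferentiableAt ℂ f z →
      HasDerivAt (fun z => Q z (f z)) (Qz z (f z) + 2 * F z (f z) * deriv f z) z)
    (hgrowth : ∀ R : ℝ, ∃ C : ℝ, ∀ z w v, ‖z‖ ≤ R →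
      ‖-Qz z w + k * smoothInv w * F z w - k * smoothInv w ^ 2 * v ^ 2‖ +
        ‖k‖ * (‖cutoff w‖ ^ 2 * ‖v‖ ^ 2) ≤ C * (1 + ‖energy k Q z w v‖))
    (z₀ α β : ℂ) (R : ℝ) :
    ∃ M : ℝ, ∀ a f, ‖a - z₀‖ ≤ R → f z₀ = α → deriv f z₀ = β →
      (∀ t ∈ Icc (0 : ℝ) 1, AnalyticAt ℂ f (z₀ + t * (a - z₀)) ∧
        deriv (deriv f) (z₀ + t * (a - z₀)) = F (z₀ + t * (a - z₀)) (f (z₀ + t * (a - z₀)))) →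
      ‖energy k Q a (f a) (deriv f a)‖ ≤ M := by
  obtain ⟨C, hC⟩ := hgrowth (‖z₀‖ + R)
  refine ⟨gronwallBound ‖energy k Q z₀ α β‖ (R * C) (R * C) 1, fun a f haR h0 h1 H => ?_⟩
  have hder := fun t (ht : t ∈ Icc (0 : ℝ) 1) => hasDerivAt_energy k hQ (H t ht).1 (H t ht).2
  have key := norm_le_gronwallBound_of_norm_deriv_right_le (a := 0) (b := 1)
    (δ := ‖energy k Q z₀ α β‖) (K := R * C) (ε := R * C)
    (fun t ht => (hder t ht).continuousAt.continuousWithinAt)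
    (fun t ht => (hder t ⟨ht.1, ht.2.le⟩).hasDerivWithinAt) (by simp [h0, h1]) ?_ 1 (by simp)
  · simpa using key
  intro t ht
  set z := z₀ + t * (a - z₀) with hz
  have hzR : ‖z‖ ≤ ‖z₀‖ + R := by
    refine (norm_add_le _ _).trans ?_
    rw [norm_mul, Complex.norm_real, Real.norm_of_nonneg ht.1]
    have := mul_le_of_le_one_left (norm_nonneg (a - z₀)) ht.2.le
    linarith
  have hb := hC z (f z) (deriv f z) hzR
  have hC0 : 0 ≤ C * (1 + ‖energy k Q z (f z) (deriv f z)‖) := le_trans (by positivity) hb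
  calc _ ≤ ‖a - z₀‖ * ‖-Qz z (f z) + k * smoothInv (f z) * F z (f z) -
          k * smoothInv (f z) ^ 2 * deriv f z ^ 2‖ +
        ‖k‖ * ‖cutoff (f z)‖ ^ 2 * ‖deriv f z‖ * (‖deriv f z‖ * ‖a - z₀‖) := by
        refine (norm_add_le _ _).trans (le_of_eq ?_)
        simp only [norm_mul, norm_pow, RCLike.norm_conj]
    _ = ‖a - z₀‖ * (‖-Qz z (f z) + k * smoothInv (f z) * F z (f z) -
          k * smoothInv (f z) ^ 2 * deriv f z ^ 2‖ +
        ‖k‖ * (‖cutoff (f z)‖ ^ 2 * ‖deriv f z‖ ^ 2)) := by ring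
    _ ≤ ‖a - z₀‖ * (C * (1 + ‖energy k Q z (f z) (deriv f z)‖)) := by gcongr
    _ ≤ R * (C * (1 + ‖energy k Q z (f z) (deriv f z)‖)) := by gcongr
    _ = R * C * ‖energy k Q z (f z) (deriv f z)‖ + R * C := by ring

lemma sq_norm_le_of_energy (k : ℂ) (Q : ℂ → ℂ → ℂ) (z w v : ℂ) :
    ‖v‖ ^ 2 ≤ 2 * ‖energy k Q z w v‖ + ‖k‖ ^ 2 + 2 * ‖Q z w‖ := by
  have h2 : v ^ 2 = energy k Q z w v - k * smoothInv w * v + Q z w := by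
    rw [energy]; ring
  have h1 : ‖v‖ ^ 2 ≤ ‖energy k Q z w v‖ + ‖k‖ * 1 * ‖v‖ + ‖Q z w‖ := by
    rw [← norm_pow, h2]
    refine (norm_add_le _ _).trans (add_le_add ((norm_sub_le _ _).trans ?_) le_rfl)
    rw [norm_mul, norm_mul]
    gcongr
    exact norm_smoothInv_le_one w
  nlinarith [sq_nonneg (‖k‖ - ‖v‖)]

lemma sq_norm_cutoff_mul_sq_norm_le (k : ℂ) (Q : ℂ → ℂ → ℂ) (z w v : ℂ) :
    ‖cutoff w‖ ^ 2 * ‖v‖ ^ 2 ≤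
      2 * ‖energy k Q z w v‖ + ‖k‖ ^ 2 + 2 * (‖cutoff w‖ ^ 2 * ‖Q z w‖) := by
  have h3 := sq_norm_le_of_energy k Q z w v
  have h4 : ‖cutoff w‖ ^ 2 ≤ 1 := pow_le_one₀ (norm_nonneg _) (norm_cutoff_le_one w)
  have h5 : 0 ≤ 2 * ‖energy k Q z w v‖ + ‖k‖ ^ 2 := by positivity
  calc ‖cutoff w‖ ^ 2 * ‖v‖ ^ 2
      ≤ ‖cutoff w‖ ^ 2 * (2 * ‖energy k Q z w v‖ + ‖k‖ ^ 2 + 2 * ‖Q z w‖) := by gcongr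
    _ = ‖cutoff w‖ ^ 2 * (2 * ‖energy k Q z w v‖ + ‖k‖ ^ 2) +
        2 * (‖cutoff w‖ ^ 2 * ‖Q z w‖) := by ring
    _ ≤ 1 * (2 * ‖energy k Q z w v‖ + ‖k‖ ^ 2) + 2 * (‖cutoff w‖ ^ 2 * ‖Q z w‖) := by gcongr
    _ = _ := by ring

/-- Growth of the energy for `y'' = 6 y² + z`. The terms of order `w` cancel; the coefficient of
the correction `k v / w` in the energy is chosen to this end. -/
lemma painleveOne_energy_growth (R : ℝ) : ∃ C : ℝ, ∀ z w v : ℂ, ‖z‖ ≤ R →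
    ‖-(2 * w) + 1 * smoothInv w * painleveOneRHS z w - 1 * smoothInv w ^ 2 * v ^ 2‖ +
      ‖(1 : ℂ)‖ * (‖cutoff w‖ ^ 2 * ‖v‖ ^ 2) ≤
      C * (1 + ‖energy 1 (fun z w => 4 * w ^ 3 + 2 * z * w) z w v‖) := by
  refine ⟨30 + 20 * R, fun z w v hz => ?_⟩
  set E := energy 1 (fun z w => 4 * w ^ 3 + 2 * z * w) z w v with hE
  have hR : 0 ≤ R := (norm_nonneg z).trans hz
  have hS := norm_cutoff_le_one w
  have hwS := norm_mul_norm_cutoff_le_one w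
  have hwwS := sq_norm_mul_norm_cutoff_le_one w
  have hχ := norm_smoothInv_le_one w
  have hQ : ‖cutoff w‖ ^ 2 * ‖4 * w ^ 3 + 2 * z * w‖ ≤ 4 + 2 * R := by
    calc ‖cutoff w‖ ^ 2 * ‖4 * w ^ 3 + 2 * z * w‖
        ≤ ‖cutoff w‖ ^ 2 * (4 * ‖w‖ ^ 3 + 2 * ‖z‖ * ‖w‖) := by
          gcongr
          refine (norm_add_le _ _).trans (le_of_eq ?_)
          simp
      _ = 4 * ((‖w‖ * ‖cutoff w‖) * (‖w‖ ^ 2 * ‖cutoff w‖)) +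
          2 * ‖z‖ * (‖cutoff w‖ * (‖w‖ * ‖cutoff w‖)) := by ring
      _ ≤ 4 * (1 * 1) + 2 * R * (1 * 1) := by gcongr
      _ = 4 + 2 * R := by ring
  have hv := sq_norm_cutoff_mul_sq_norm_le 1 (fun z w => 4 * w ^ 3 + 2 * z * w) z w v
  rw [← hE, norm_one] at hv
  have hid : -(2 * w) + 1 * smoothInv w * painleveOneRHS z w - 1 * smoothInv w ^ 2 * v ^ 2 =
      2 * (w * cutoff w) - 4 * (w * cutoff w * cutoff w) + z * smoothInv w
        - 2 * (z * smoothInv w * (1 - cutoff w)) - E * smoothInv w ^ 2 + smoothInv w ^ 3 * v := by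
    rw [hE, energy, painleveOneRHS]
    linear_combination (6 * w - 4 * w * (1 + w * smoothInv w - cutoff w) - 2 * z * smoothInv w) *
      mul_smoothInv w
  have h3 := norm_smoothInv_pow_three_mul_le w v
  have hnorm : ‖-(2 * w) + 1 * smoothInv w * painleveOneRHS z w - 1 * smoothInv w ^ 2 * v ^ 2‖ ≤
      2 * 1 + 4 * (1 * 1) + R * 1 + 2 * (R * 1 * 1) + ‖E‖ * 1 +
        (1 + ‖cutoff w‖ ^ 2 * ‖v‖ ^ 2) := by
    rw [hid]
    refine (norm_add_le _ _).trans (add_le_add ((norm_sub_le _ _).trans (add_le_add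
      ((norm_sub_le _ _).trans (add_le_add ((norm_add_le _ _).trans (add_le_add
        ((norm_sub_le _ _).trans (add_le_add ?_ ?_)) ?_)) ?_)) ?_)) h3)
    · rw [norm_mul, norm_mul, Complex.norm_two]; gcongr
    · rw [norm_mul, norm_mul, norm_mul, Complex.norm_ofNat]; gcongr
    · rw [norm_mul]; gcongr
    · rw [norm_mul, norm_mul, norm_mul, Complex.norm_two]
      gcongr
      exact norm_one_sub_cutoff_le_one w
    · rw [norm_mul, norm_pow]
      gcongr
      exact pow_le_one₀ (norm_nonneg _) hχ
  rw [norm_one]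
  nlinarith [norm_nonneg E, mul_nonneg hR (norm_nonneg E)]

/-- Growth of the energy for `y'' = 2 y³ + (p z + q) y + a`; the terms of order `w²` cancel. -/
lemma painleveTwo_energy_growth (p q a : ℂ) (R : ℝ) : ∃ C : ℝ, ∀ z w v : ℂ, ‖z‖ ≤ R →
    ‖-(p * w ^ 2) + p * smoothInv w * (2 * w ^ 3 + (p * z + q) * w + a) -
        p * smoothInv w ^ 2 * v ^ 2‖ + ‖p‖ * (‖cutoff w‖ ^ 2 * ‖v‖ ^ 2) ≤
      C * (1 + ‖energy p (fun z w => w ^ 4 + (p * z + q) * w ^ 2 + 2 * a * w) z w v‖) := by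
  set T := ‖p‖ * R + ‖q‖ with hT
  set P := ‖p‖ with hP
  set A := ‖a‖ with hA
  refine ⟨P * (1 + T + A + 2 * A + 1) + P * P +
    (P * P + P) * (2 + P ^ 2 + 2 * (1 + T + 2 * A)) + P, fun z w v hz => ?_⟩
  set τ := p * z + q with hτ
  set E := energy p (fun z w => w ^ 4 + (p * z + q) * w ^ 2 + 2 * a * w) z w v with hE
  have hR : 0 ≤ R := (norm_nonneg z).trans hz
  have hP0 : 0 ≤ P := norm_nonneg p
  have hA0 : 0 ≤ A := norm_nonneg a
  have hT0 : 0 ≤ T := by positivity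
  have hτT : ‖τ‖ ≤ T := by
    refine (norm_add_le _ _).trans ?_
    rw [norm_mul, hT]
    gcongr
  have hS := norm_cutoff_le_one w
  have hwS := norm_mul_norm_cutoff_le_one w
  have hwwS := sq_norm_mul_norm_cutoff_le_one w
  have hχ := norm_smoothInv_le_one w
  have h1S := norm_one_sub_cutoff_le_one w
  have hQ : ‖cutoff w‖ ^ 2 * ‖w ^ 4 + τ * w ^ 2 + 2 * a * w‖ ≤ 1 + T + 2 * A := by
    calc ‖cutoff w‖ ^ 2 * ‖w ^ 4 + τ * w ^ 2 + 2 * a * w‖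
        ≤ ‖cutoff w‖ ^ 2 * (‖w‖ ^ 4 + ‖τ‖ * ‖w‖ ^ 2 + 2 * A * ‖w‖) := by
          gcongr
          refine (norm_add₃_le).trans (le_of_eq ?_)
          simp [hA]
      _ = (‖w‖ ^ 2 * ‖cutoff w‖) * (‖w‖ ^ 2 * ‖cutoff w‖) +
          ‖τ‖ * (‖cutoff w‖ * (‖w‖ ^ 2 * ‖cutoff w‖)) +
          2 * A * (‖cutoff w‖ * (‖w‖ * ‖cutoff w‖)) := by ring
      _ ≤ 1 * 1 + T * (1 * 1) + 2 * A * (1 * 1) := by gcongr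
      _ = _ := by ring
  have hv := sq_norm_cutoff_mul_sq_norm_le p
    (fun z w => w ^ 4 + (p * z + q) * w ^ 2 + 2 * a * w) z w v
  rw [← hE] at hv
  have hv' : ‖cutoff w‖ ^ 2 * ‖v‖ ^ 2 ≤ 2 * ‖E‖ + P ^ 2 + 2 * (1 + T + 2 * A) :=
    hv.trans (by gcongr)
  have hid : -(p * w ^ 2) + p * smoothInv w * (2 * w ^ 3 + τ * w + a) -
        p * smoothInv w ^ 2 * v ^ 2 =
      p * (-(w * cutoff w * (w * cutoff w)) + τ * (cutoff w * (1 - cutoff w)) + a * smoothInv w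
        - 2 * (a * (smoothInv w * (1 - cutoff w))) - E * smoothInv w ^ 2 +
        p * (smoothInv w ^ 3 * v)) := by
    rw [hE, energy]
    simp only [← hτ]
    linear_combination p * (2 * w ^ 2 - w ^ 2 * (1 + w * smoothInv w - cutoff w) + τ
      - τ * (1 + w * smoothInv w - cutoff w) - 2 * a * smoothInv w) * mul_smoothInv w
  have h3 := norm_smoothInv_pow_three_mul_le w v
  have hnorm : ‖-(p * w ^ 2) + p * smoothInv w * (2 * w ^ 3 + τ * w + a) -
      p * smoothInv w ^ 2 * v ^ 2‖ ≤ P * (1 * 1 + T * (1 * 1) + A * 1 + 2 * (A * (1 * 1)) +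
        ‖E‖ * 1 + P * (1 + ‖cutoff w‖ ^ 2 * ‖v‖ ^ 2)) := by
    rw [hid, norm_mul]
    refine mul_le_mul_of_nonneg_left ?_ hP0
    refine (norm_add_le _ _).trans (add_le_add ((norm_sub_le _ _).trans (add_le_add
      ((norm_sub_le _ _).trans (add_le_add ((norm_add_le _ _).trans (add_le_add
        ((norm_add_le _ _).trans (add_le_add ?_ ?_)) ?_)) ?_)) ?_)) ?_)
    · rw [norm_neg, norm_mul, norm_mul]; gcongr
    · rw [norm_mul, norm_mul]; gcongr
    · rw [norm_mul]; gcongr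
    · rw [norm_mul, norm_mul, norm_mul, Complex.norm_two]; gcongr
    · rw [norm_mul, norm_pow]
      gcongr
      exact pow_le_one₀ (norm_nonneg _) hχ
    · rw [norm_mul]; gcongr
  refine (add_le_add hnorm le_rfl).trans ?_
  set X := ‖cutoff w‖ ^ 2 * ‖v‖ ^ 2 with hX
  set B := 2 + P ^ 2 + 2 * (1 + T + 2 * A) with hB
  have hB0 : 2 ≤ B := by rw [hB]; nlinarith
  have hXB : X ≤ B * (1 + ‖E‖) := by
    have : 0 ≤ (B - 2) * ‖E‖ := mul_nonneg (by linarith) (norm_nonneg E)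
    nlinarith
  have hXc : (P * P + P) * X ≤ (P * P + P) * (B * (1 + ‖E‖)) := by gcongr
  have : 0 ≤ (P * (1 + T + A + 2 * A) + P * P) * ‖E‖ + P + P * ‖E‖ := by positivity
  nlinarith

/-! ### Regular points and poles -/

/-- A coordinate with constant speed one is the time. -/
lemma eq_add_of_hasDerivAt_one {x : ℂ → ℂ} {δ : ℝ}
    (hx : ∀ h ∈ Metric.ball (0 : ℂ) δ, HasDerivAt x 1 h) :
    ∀ h ∈ Metric.ball (0 : ℂ) δ, x h = x 0 + h := by
  intro h hh
  have h0 : (0 : ℂ) ∈ Metric.ball (0 : ℂ) δ :=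
    Metric.mem_ball_self (Metric.pos_of_mem_ball hh)
  have hd : ∀ k ∈ Metric.ball (0 : ℂ) δ, HasDerivAt (fun k => x k - k) 0 k := fun k hk =>
    ((hx k hk).sub (hasDerivAt_id' k)).congr_deriv (sub_self 1)
  have := Metric.isOpen_ball.is_const_of_deriv_eq_zero (convex_ball (0 : ℂ) δ).isPreconnected
    (fun k hk => (hd k hk).differentiableAt.differentiableWithinAt)
    (fun k hk => (hd k hk).deriv) hh h0
  simp only [sub_zero] at this
  linear_combination this

/-- Uniform local solvability for non-autonomous planar systems `ξ' = G₁(z, ξ, η)`,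
`η' = G₂(z, ξ, η)` with polynomial right-hand sides. -/
lemma exists_uniform_planar_solution {G₁ G₂ : ℂ → ℂ → ℂ → ℂ} (q₁ q₂ : MvPolynomial (Fin 3) ℂ)
    (h₁ : ∀ x, MvPolynomial.eval x q₁ = G₁ (x 0) (x 1) (x 2))
    (h₂ : ∀ x, MvPolynomial.eval x q₂ = G₂ (x 0) (x 1) (x 2)) (R : ℝ) :
    ∃ δ > 0, ∀ a x y : ℂ, ‖a‖ ≤ R → ‖x‖ ≤ R → ‖y‖ ≤ R → ∃ ξ η : ℂ → ℂ, ξ a = x ∧ η a = y ∧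
      (∀ z ∈ Metric.ball a δ, HasDerivAt ξ (G₁ z (ξ z) (η z)) z) ∧
      ∀ z ∈ Metric.ball a δ, HasDerivAt η (G₂ z (ξ z) (η z)) z := by
  obtain ⟨δ, hδ, H⟩ := exists_uniform_local_solution
    (![1, q₁, q₂] : Fin 3 → MvPolynomial (Fin 3) ℂ) (isCompact_closedBall (0 : Fin 3 → ℂ) R)
  refine ⟨δ, hδ, fun a x y ha hx hy => ?_⟩
  have hR : 0 ≤ R := (norm_nonneg a).trans ha
  obtain ⟨X, hX0, hX⟩ := H ![a, x, y] (by
    rw [mem_closedBall_zero_iff, pi_norm_le_iff_of_nonneg hR]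
    intro i
    fin_cases i <;> simpa)
  have hXi := fun h hh => hasDerivAt_pi.1 (hX h hh)
  have ht : ∀ h ∈ Metric.ball (0 : ℂ) δ, X h 0 = a + h := by
    intro h hh
    rw [eq_add_of_hasDerivAt_one (x := fun h => X h 0)
      (fun h hh => by simpa using hXi h hh 0) h hh, hX0]
    simp
  have hmem : ∀ z ∈ Metric.ball a δ, z - a ∈ Metric.ball (0 : ℂ) δ := fun z hz => by
    rwa [mem_ball_zero_iff, ← dist_eq_norm]
  refine ⟨fun z => X (z - a) 1, fun z => X (z - a) 2, by simp [hX0], by simp [hX0],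
    fun z hz => ?_, fun z hz => ?_⟩
  · have := hXi _ (hmem z hz) 1
    simp only [Matrix.cons_val, h₁, ht _ (hmem z hz), add_sub_cancel] at this
    exact this.comp_sub_const z a
  · have := hXi _ (hmem z hz) 2
    simp only [Matrix.cons_val, h₂, ht _ (hmem z hz), add_sub_cancel] at this
    exact this.comp_sub_const z a

/-- Bounded initial data have analytic solutions on discs of a uniform radius. -/
lemma exists_uniform_analytic_solution {F : ℂ → ℂ → ℂ} (q : MvPolynomial (Fin 3) ℂ)
    (hq : ∀ x, MvPolynomial.eval x q = F (x 0) (x 1)) (R : ℝ) :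
    ∃ δ > 0, ∀ a w v : ℂ, ‖a‖ ≤ R → ‖w‖ ≤ R → ‖v‖ ≤ R →
      ∃ g, IsMeromorphicSolutionOn F (Metric.ball a δ) g ∧ AnalyticAt ℂ g a ∧ g a = w ∧
        deriv g a = v := by
  obtain ⟨δ, hδ, H⟩ := exists_uniform_planar_solution (G₁ := fun _ _ y => y)
    (G₂ := fun z x _ => F z x) (.X 2) q (by simp) hq R
  refine ⟨δ, hδ, fun a w v ha hw hv => ?_⟩
  obtain ⟨ξ, η, hξ0, hη0, hξ, hη⟩ := H a w v ha hw hv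
  have hana : AnalyticOnNhd ℂ ξ (Metric.ball a δ) := DifferentiableOn.analyticOnNhd
    (fun z hz => (hξ z hz).differentiableAt.differentiableWithinAt) Metric.isOpen_ball
  have ha' : a ∈ Metric.ball a δ := Metric.mem_ball_self hδ
  refine ⟨ξ, isMeromorphicSolutionOn_of_analyticOnNhd hana fun z hz => ?_,
    hana a ha', hξ0, by rw [(hξ a ha').deriv, hη0]⟩
  have he : deriv ξ =ᶠ[𝓝 z] η := by
    filter_upwards [Metric.isOpen_ball.mem_nhds hz] with y hy using (hξ y hy).deriv
  rw [he.deriv_eq, (hη z hz).deriv]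

/-- A solution written in a chart at infinity, where `u` is a local coordinate vanishing exactly at
the poles of `g`, is a meromorphic solution. -/
lemma exists_meromorphicSolution_of_chart {F : ℂ → ℂ → ℂ}
    (hF : Continuous (Function.uncurry F)) {a : ℂ} {δ : ℝ} (hδ : 0 < δ) {u u' g W : ℂ → ℂ}
    (hu : ∀ z ∈ Metric.ball a δ, HasDerivAt u (u' z) z)
    (hu0 : ∀ z ∈ Metric.ball a δ, u z = 0 → u' z ≠ 0) (hua : u a ≠ 0)
    (hg : MeromorphicOn g (Metric.ball a δ))
    (hgW : ∀ z ∈ Metric.ball a δ, u z ≠ 0 → HasDerivAt g (W z) z ∧ HasDerivAt W (F z (g z)) z) :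
    ∃ f, IsMeromorphicSolutionOn F (Metric.ball a δ) f ∧ AnalyticAt ℂ f a ∧ f a = g a ∧
      deriv f a = W a := by
  have hnear : ∀ z ∈ Metric.ball a δ, u z ≠ 0 → ∀ᶠ x in 𝓝 z, x ∈ Metric.ball a δ ∧ u x ≠ 0 :=
    fun z hz h => (show ∀ᶠ x in 𝓝 z, x ∈ Metric.ball a δ from Metric.isOpen_ball.mem_nhds hz).and
      ((hu z hz).continuousAt.eventually_ne h)
  have ha : a ∈ Metric.ball a δ := Metric.mem_ball_self hδ
  have hga : AnalyticAt ℂ g a := by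
    rw [Complex.analyticAt_iff_eventually_differentiableAt]
    filter_upwards [hnear a ha hua] with x hx
    exact (hgW x hx.1 hx.2).1.differentiableAt
  have hode : ∀ z ∈ Metric.ball a δ, u z ≠ 0 → deriv (deriv g) z = F z (g z) := by
    intro z hz h
    have he : deriv g =ᶠ[𝓝 z] W := by
      filter_upwards [hnear z hz h] with x hx using (hgW x hx.1 hx.2).1.deriv
    rw [he.deriv_eq, (hgW z hz h).2.deriv]
  have hfg : toMeromorphicNFOn g (Metric.ball a δ) =ᶠ[𝓝 a] g :=
    ((meromorphicNFOn_toMeromorphicNFOn g _ ha).eventuallyEq_nhdsNE_iff_eventuallyEq_nhds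
      hga.meromorphicNFAt).1 (hg.toMeromorphicNFOn_eq_self_on_nhdsNE ha)
  refine ⟨toMeromorphicNFOn g (Metric.ball a δ), .toMeromorphicNFOn hg hF fun z hz => ?_,
    hga.congr hfg.symm, hfg.eq_of_nhds, by rw [hfg.deriv_eq, (hgW a ha hua).1.deriv]⟩
  by_cases h : u z = 0
  · filter_upwards [(hu z hz).eventually_ne (hu0 z hz h) (c := 0),
      mem_nhdsWithin_of_mem_nhds (Metric.isOpen_ball.mem_nhds hz)] with x h1 h2
    exact hode x h2 h1
  · filter_upwards [(hnear z hz h).filter_mono nhdsWithin_le_nhds] with x hx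
    exact hode x hx.1 hx.2

/-- Solutions of `y'' = 6 y² + z` near infinity: in the coordinates `u`, `b` given by `y = u⁻²`,
`y' = -2 u⁻³ - (z / 2) u - u² / 2 + b u³` the equation is a polynomial system, transversal to
`u = 0`. -/
lemma painleveOne_pole_chart (R : ℝ) :
    ∃ δ > 0, ∀ a u b : ℂ, ‖a‖ ≤ R → ‖u‖ ≤ R → ‖b‖ ≤ R → u ≠ 0 →
      ∃ g, IsMeromorphicSolutionOn painleveOneRHS (Metric.ball a δ) g ∧ AnalyticAt ℂ g a ∧
        g a = (u ^ 2)⁻¹ ∧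
        deriv g a = -2 * (u ^ 3)⁻¹ - a / 2 * u - u ^ 2 / 2 + b * u ^ 3 := by
  obtain ⟨δ, hδ, H⟩ := exists_uniform_planar_solution
    (G₁ := fun z u b => 1 + z / 4 * u ^ 4 + u ^ 5 / 4 - b * u ^ 6 / 2)
    (G₂ := fun z u b => u * (z / 2 + u - 3 * b * u ^ 2) * (z / 4 + u / 4 - b * u ^ 2 / 2))
    (1 + .C (1 / 4) * .X 0 * .X 1 ^ 4 + .C (1 / 4) * .X 1 ^ 5 - .C (1 / 2) * .X 2 * .X 1 ^ 6)
    (.X 1 * (.C (1 / 2) * .X 0 + .X 1 - .C 3 * .X 2 * .X 1 ^ 2) *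
      (.C (1 / 4) * .X 0 + .C (1 / 4) * .X 1 - .C (1 / 2) * .X 2 * .X 1 ^ 2))
    (fun x => by
      simp only [map_add, map_sub, map_mul, map_pow, map_one, MvPolynomial.eval_C,
        MvPolynomial.eval_X]
      ring)
    (fun x => by
      simp only [map_add, map_sub, map_mul, map_pow, MvPolynomial.eval_C, MvPolynomial.eval_X]
      ring) R
  refine ⟨δ, hδ, fun a u b ha hu hb hu0 => ?_⟩
  obtain ⟨U, B, hUa, hBa, h1, h2⟩ := H a u b ha hu hb
  have hUana : AnalyticOnNhd ℂ U (Metric.ball a δ) := DifferentiableOn.analyticOnNhd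
    (fun z hz => (h1 z hz).differentiableAt.differentiableWithinAt) Metric.isOpen_ball
  have hFc : Continuous (Function.uncurry painleveOneRHS) := by
    unfold Function.uncurry painleveOneRHS
    fun_prop
  have hW : ∀ z ∈ Metric.ball a δ, U z ≠ 0 → HasDerivAt (fun z => (U z ^ 2)⁻¹)
      (-2 * (U z ^ 3)⁻¹ - z / 2 * U z - U z ^ 2 / 2 + B z * U z ^ 3) z := by
    intro z hz h
    refine (((h1 z hz).pow 2).inv (pow_ne_zero 2 h)).congr_deriv ?_
    simp only [Pi.pow_apply]
    field_simp
    ring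
  have hW' : ∀ z ∈ Metric.ball a δ, U z ≠ 0 → HasDerivAt
      (fun z => -2 * (U z ^ 3)⁻¹ - z / 2 * U z - U z ^ 2 / 2 + B z * U z ^ 3)
      (painleveOneRHS z (U z ^ 2)⁻¹) z := by
    intro z hz h
    have e1 := (((h1 z hz).pow 3).inv (pow_ne_zero 3 h)).const_mul (-2)
    have e2 := ((hasDerivAt_id' z).div_const 2).mul (h1 z hz)
    have e3 := ((h1 z hz).pow 2).div_const 2
    have e4 := (h2 z hz).mul ((h1 z hz).pow 3)
    refine (((e1.sub e2).sub e3).add e4).congr_deriv ?_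
    simp only [Pi.pow_apply, painleveOneRHS]
    field_simp
    ring
  obtain ⟨f, hf, hfa, hf0, hf1⟩ := exists_meromorphicSolution_of_chart hFc hδ h1
    (fun z _ h => by simp [h]) (by rwa [hUa])
    (fun z hz => ((hUana z hz).meromorphicAt.pow 2).inv) fun z hz h => ⟨hW z hz h, hW' z hz h⟩
  exact ⟨f, hf, hfa, by simp [hf0, hUa], by rw [hf1, hUa, hBa]⟩

/-- Solutions of `y'' = 2 y³ + (p z + q) y + a` near infinity: in the coordinates `u`, `b` given by
`y = u⁻¹`, `y' = σ (u⁻² + (p z + q) / 2) + c u + b u²`, with `σ = ±1` and `c = σ a - p / 2`, the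
equation is a polynomial system, transversal to `u = 0`. -/
lemma painleveTwo_pole_chart (p q a σ : ℂ) (hσ : σ ^ 2 = 1) (R : ℝ) :
    ∃ δ > 0, ∀ z₁ u b : ℂ, ‖z₁‖ ≤ R → ‖u‖ ≤ R → ‖b‖ ≤ R → u ≠ 0 →
      ∃ g, IsMeromorphicSolutionOn (fun z w => 2 * w ^ 3 + (p * z + q) * w + a)
          (Metric.ball z₁ δ) g ∧ AnalyticAt ℂ g z₁ ∧ g z₁ = u⁻¹ ∧
        deriv g z₁ = σ * ((u ^ 2)⁻¹ + (p * z₁ + q) / 2) + (σ * a - p / 2) * u + b * u ^ 2 := by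
  set c := σ * a - p / 2 with hc
  have hσ0 : σ ≠ 0 := by rintro rfl; simp at hσ
  obtain ⟨δ, hδ, H⟩ := exists_uniform_planar_solution
    (G₁ := fun z u b => -σ * (1 + (p * z + q) / 2 * u ^ 2) - c * u ^ 3 - b * u ^ 4)
    (G₂ := fun z u b => (c + 2 * b * u) * (σ / 2 * (p * z + q) + c * u + b * u ^ 2))
    (-.C σ * (1 + .C (1 / 2) * (.C p * .X 0 + .C q) * .X 1 ^ 2) - .C c * .X 1 ^ 3 -
        .X 2 * .X 1 ^ 4)
    ((.C c + .C 2 * .X 2 * .X 1) * (.C (σ / 2) * (.C p * .X 0 + .C q) + .C c * .X 1 +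
        .X 2 * .X 1 ^ 2))
    (fun x => by
      simp only [map_add, map_sub, map_mul, map_pow, map_one, map_neg, MvPolynomial.eval_C,
        MvPolynomial.eval_X]
      ring)
    (fun x => by
      simp only [map_add, map_mul, map_pow, MvPolynomial.eval_C, MvPolynomial.eval_X]) R
  refine ⟨δ, hδ, fun z₁ u b ha hu hb hu0 => ?_⟩
  obtain ⟨U, B, hUa, hBa, h1, h2⟩ := H z₁ u b ha hu hb
  have hUana : AnalyticOnNhd ℂ U (Metric.ball z₁ δ) := DifferentiableOn.analyticOnNhd
    (fun z hz => (h1 z hz).differentiableAt.differentiableWithinAt) Metric.isOpen_ball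
  have hFc : Continuous (Function.uncurry fun z w : ℂ => 2 * w ^ 3 + (p * z + q) * w + a) := by
    unfold Function.uncurry
    fun_prop
  have hW : ∀ z ∈ Metric.ball z₁ δ, U z ≠ 0 → HasDerivAt (fun z => (U z)⁻¹)
      (σ * ((U z ^ 2)⁻¹ + (p * z + q) / 2) + c * U z + B z * U z ^ 2) z := by
    intro z hz h
    refine ((h1 z hz).inv h).congr_deriv ?_
    field_simp
    ring
  have hW' : ∀ z ∈ Metric.ball z₁ δ, U z ≠ 0 → HasDerivAt
      (fun z => σ * ((U z ^ 2)⁻¹ + (p * z + q) / 2) + c * U z + B z * U z ^ 2)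
      (2 * (U z)⁻¹ ^ 3 + (p * z + q) * (U z)⁻¹ + a) z := by
    intro z hz h
    have e0 : HasDerivAt (fun z => (p * z + q) / 2) (p / 2) z := by
      simpa using (((hasDerivAt_id' z).const_mul p).add_const q).div_const 2
    have e1 := ((((h1 z hz).pow 2).inv (pow_ne_zero 2 h)).add e0).const_mul σ
    have e2 := (h1 z hz).const_mul c
    have e3 := (h2 z hz).mul ((h1 z hz).pow 2)
    refine ((e1.add e2).add e3).congr_deriv ?_
    simp only [Pi.pow_apply]
    simp only [hc]
    field_simp
    linear_combination (8 * U z + 4 * U z ^ 3 * (p * z + q) + 4 * U z ^ 4 * a) * hσ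
  obtain ⟨f, hf, hfa, hf0, hf1⟩ := exists_meromorphicSolution_of_chart hFc hδ h1
    (fun z _ h => by simp [h, hσ0]) (by rwa [hUa])
    (fun z hz => (hUana z hz).meromorphicAt.inv) fun z hz h => ⟨hW z hz h, hW' z hz h⟩
  exact ⟨f, hf, hfa, by simp [hf0, hUa], by rw [hf1, hUa, hBa]⟩

/-! ### The Painlevé property -/

lemma norm_cutoff_le_of_mul_eq_one {w u : ℂ} (h : w * u = 1) : ‖cutoff w‖ ≤ ‖u‖ ^ 2 := by
  have h1 : ‖w‖ * ‖u‖ = 1 := by rw [← norm_mul, h, norm_one]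
  have h2 := norm_cutoff_mul w
  have h3 : ‖cutoff w‖ * ‖w‖ ^ 2 ≤ 1 := by nlinarith [norm_nonneg (cutoff w)]
  calc ‖cutoff w‖ = ‖cutoff w‖ * ‖w‖ ^ 2 * ‖u‖ ^ 2 := by
        rw [mul_assoc, ← mul_pow, h1]; ring
    _ ≤ 1 * ‖u‖ ^ 2 := by gcongr
    _ = ‖u‖ ^ 2 := one_mul _

/-- For `w = 1 / u`, the smoothed inverse of `w` is `u` up to a small error. -/
lemma smoothInv_eq_of_mul_eq_one {w u : ℂ} (h : w * u = 1) :
    smoothInv w = u - u * cutoff w := by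
  linear_combination u * mul_smoothInv w - smoothInv w * h

/-- Near infinity, bounded energy means bounded coordinates in the pole chart of
`y'' = 6 y² + z`, for the right choice of the square root `u` of `1 / w`. -/
lemma painleveOne_chart_bound {R M : ℝ} {a w v u : ℂ} (ha : ‖a‖ ≤ R)
    (hE : ‖energy 1 (fun z w => 4 * w ^ 3 + 2 * z * w) a w v‖ ≤ M)
    (hu0 : u ≠ 0) (hu1 : ‖u‖ ≤ 1) (hw : w * u ^ 2 = 1)
    (hsign : ‖v * u ^ 3 + 2‖ ≤ ‖v * u ^ 3 - 2‖) :
    ∃ b, ‖b‖ ≤ (M + 2 + 2 * R) ^ 2 + 2 * (M + 2 + 2 * R) + M + 2 ∧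
      v = -2 * (u ^ 3)⁻¹ - a / 2 * u - u ^ 2 / 2 + b * u ^ 3 := by
  have hR : 0 ≤ R := (norm_nonneg a).trans ha
  have hM : 0 ≤ M := (norm_nonneg _).trans hE
  set E := energy 1 (fun z w => 4 * w ^ 3 + 2 * z * w) a w v with hEdef
  have hE' : E = v ^ 2 + smoothInv w * v - 4 * w ^ 3 - 2 * a * w := by
    rw [hEdef, energy]; ring
  set P := v + 2 * (u ^ 3)⁻¹ with hP
  have hPu : P * u ^ 3 = v * u ^ 3 + 2 := by rw [hP]; field_simp
  have hw' : w = (u ^ 2)⁻¹ := eq_inv_of_mul_eq_one_left hw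
  have hχ : ‖smoothInv w‖ ≤ 1 := norm_smoothInv_le_one w
  have hs : ‖cutoff w‖ ≤ ‖u‖ ^ 4 := by
    have := norm_cutoff_le_of_mul_eq_one hw
    rwa [norm_pow, ← pow_mul] at this
  have hfac : 2 ≤ ‖P * u ^ 3 - 4‖ := by
    have h1 : P * u ^ 3 - 4 = v * u ^ 3 - 2 := by rw [hPu]; ring
    have h2 : (4 : ℂ) = (v * u ^ 3 + 2) - (v * u ^ 3 - 2) := by ring
    have h3 : (4 : ℝ) ≤ ‖v * u ^ 3 + 2‖ + ‖v * u ^ 3 - 2‖ := by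
      have := norm_sub_le (v * u ^ 3 + 2) (v * u ^ 3 - 2)
      rwa [← h2, Complex.norm_ofNat] at this
    rw [h1]; linarith
  have hu3 : ‖u‖ ^ 3 ≤ 1 := pow_le_one₀ (norm_nonneg u) hu1
  have hPb : ‖P‖ ≤ M + 2 + 2 * R := by
    have hid : P * (P * u ^ 3 - 4) = E * u ^ 3 - smoothInv w * (P * u ^ 3 - 2) + 2 * a * u := by
      rw [hE', hP, hw']
      field_simp
      ring
    have h1 : ‖P‖ * ‖P * u ^ 3 - 4‖ ≤ M * 1 + 1 * (‖P‖ * 1 + 2) + 2 * R * 1 := by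
      rw [← norm_mul, hid]
      refine (norm_add_le _ _).trans (add_le_add ((norm_sub_le _ _).trans (add_le_add ?_ ?_)) ?_)
      · rw [norm_mul, norm_pow]; gcongr
      · rw [norm_mul]
        gcongr
        refine (norm_sub_le _ _).trans ?_
        rw [norm_mul, norm_pow, Complex.norm_two]
        gcongr
      · rw [norm_mul, norm_mul, Complex.norm_two]; gcongr
    nlinarith [norm_nonneg P]
  refine ⟨(P + a / 2 * u + u ^ 2 / 2) / u ^ 3, ?_, ?_⟩
  · set b := (P + a / 2 * u + u ^ 2 / 2) / u ^ 3 with hb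
    have hid : 4 * b = P ^ 2 + P * u ^ 2 - (E + (P * u ^ 3 - 2) * (cutoff w * (u ^ 3)⁻¹ * u ^ 2)) := by
      have h1 : smoothInv w = u ^ 2 - u ^ 2 * cutoff w := smoothInv_eq_of_mul_eq_one hw
      rw [hE', hb, h1, hP, hw']
      field_simp
      ring
    have hcu : ‖cutoff w * (u ^ 3)⁻¹ * u ^ 2‖ ≤ 1 := by
      have hupos : 0 < ‖u‖ := norm_pos_iff.2 hu0
      rw [norm_mul, norm_mul, norm_inv, norm_pow, norm_pow]
      calc ‖cutoff w‖ * (‖u‖ ^ 3)⁻¹ * ‖u‖ ^ 2 ≤ ‖u‖ ^ 4 * (‖u‖ ^ 3)⁻¹ * ‖u‖ ^ 2 := by gcongr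
        _ = ‖u‖ ^ 3 := by field_simp
        _ ≤ 1 := hu3
    have h4 : 4 * ‖b‖ ≤ (M + 2 + 2 * R) ^ 2 + (M + 2 + 2 * R) * 1 +
        (M + ((M + 2 + 2 * R) * 1 + 2) * 1) := by
      rw [← Complex.norm_ofNat (n := 4), ← norm_mul, hid]
      refine (norm_sub_le _ _).trans (add_le_add ((norm_add_le _ _).trans (add_le_add ?_ ?_))
        ((norm_add_le _ _).trans (add_le_add hE ?_)))
      · rw [norm_pow]; gcongr
      · rw [norm_mul, norm_pow]
        gcongr
        exact pow_le_one₀ (norm_nonneg u) hu1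
      · rw [norm_mul]
        gcongr
        refine (norm_sub_le _ _).trans ?_
        rw [norm_mul, norm_pow, Complex.norm_two]
        gcongr
    nlinarith [norm_nonneg b]
  · rw [hP]
    field_simp
    ring

/-- Initial data of `y'' = 6 y² + z` with bounded energy have meromorphic solutions on discs of a
uniform radius. -/
lemma painleveOne_uniform_local (R M : ℝ) :
    ∃ δ > 0, ∀ a w v : ℂ, ‖a‖ ≤ R →
      ‖energy 1 (fun z w => 4 * w ^ 3 + 2 * z * w) a w v‖ ≤ M →
      ∃ g, IsMeromorphicSolutionOn painleveOneRHS (Metric.ball a δ) g ∧ AnalyticAt ℂ g a ∧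
        g a = w ∧ deriv g a = v := by
  obtain ⟨δ₁, hδ₁, H₁⟩ := exists_uniform_analytic_solution (F := painleveOneRHS)
    (.C 6 * .X 1 ^ 2 + .X 0) (fun x => by simp [painleveOneRHS])
    (max R (max 1 (1 + (2 * M + 1 + 2 * (4 + 2 * R)))))
  obtain ⟨δ₂, hδ₂, H₂⟩ := painleveOne_pole_chart
    (max R (max 1 ((M + 2 + 2 * R) ^ 2 + 2 * (M + 2 + 2 * R) + M + 2)))
  refine ⟨min δ₁ δ₂, lt_min hδ₁ hδ₂, fun a w v ha hE => ?_⟩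
  have hR : 0 ≤ R := (norm_nonneg a).trans ha
  rcases le_or_gt ‖w‖ 1 with hw | hw
  · have hv : ‖v‖ ≤ 1 + (2 * M + 1 + 2 * (4 + 2 * R)) := by
      have h1 := sq_norm_le_of_energy 1 (fun z w => 4 * w ^ 3 + 2 * z * w) a w v
      have h2 : ‖4 * w ^ 3 + 2 * a * w‖ ≤ 4 * 1 ^ 3 + 2 * R * 1 := by
        refine (norm_add_le _ _).trans ?_
        rw [norm_mul, norm_mul, norm_mul, norm_pow, Complex.norm_ofNat, Complex.norm_two]
        gcongr
      rw [norm_one] at h1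
      nlinarith [sq_nonneg (‖v‖ - 1)]
    obtain ⟨g, hg, h⟩ := H₁ a w v (ha.trans (le_max_left _ _))
      (hw.trans ((le_max_left _ _).trans (le_max_right _ _)))
      (hv.trans ((le_max_right _ _).trans (le_max_right _ _)))
    exact ⟨g, hg.mono (Metric.ball_subset_ball (min_le_left _ _)), h⟩
  · have hw0 : w ≠ 0 := by rintro rfl; simp at hw; linarith
    obtain ⟨u, hu, hsign⟩ : ∃ u : ℂ, w * u ^ 2 = 1 ∧ ‖v * u ^ 3 + 2‖ ≤ ‖v * u ^ 3 - 2‖ := by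
      obtain ⟨u, hu⟩ := IsAlgClosed.exists_pow_nat_eq w⁻¹ (n := 2) two_pos
      rcases le_total ‖v * u ^ 3 + 2‖ ‖v * u ^ 3 - 2‖ with h | h
      · exact ⟨u, by rw [hu, mul_inv_cancel₀ hw0], h⟩
      · refine ⟨-u, by rw [neg_sq, hu, mul_inv_cancel₀ hw0], ?_⟩
        have e1 : v * (-u) ^ 3 + 2 = -(v * u ^ 3 - 2) := by ring
        have e2 : v * (-u) ^ 3 - 2 = -(v * u ^ 3 + 2) := by ring
        rwa [e1, e2, norm_neg, norm_neg]
    have hu0 : u ≠ 0 := by rintro rfl; simp at hu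
    have hu1 : ‖u‖ ≤ 1 := by
      have h1 : ‖w‖ * ‖u‖ ^ 2 = 1 := by rw [← norm_pow, ← norm_mul, hu, norm_one]
      by_contra hlt
      push Not at hlt
      nlinarith [one_lt_pow₀ hlt two_ne_zero]
    obtain ⟨b, hb, hvb⟩ := painleveOne_chart_bound ha hE hu0 hu1 hu hsign
    obtain ⟨g, hg, hga, hg0, hg1⟩ := H₂ a u b (ha.trans (le_max_left _ _))
      (hu1.trans ((le_max_left _ _).trans (le_max_right _ _)))
      (hb.trans ((le_max_right _ _).trans (le_max_right _ _))) hu0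
    exact ⟨g, hg.mono (Metric.ball_subset_ball (min_le_right _ _)), hga,
      by rw [hg0, ← eq_inv_of_mul_eq_one_left hu], by rw [hg1, ← hvb]⟩

/-- **Painlevé property of the first Painlevé equation.** -/
theorem painleveOne_exists_meromorphic (z₀ α β : ℂ) :
    ∃ Y, IsMeromorphicSolutionOn painleveOneRHS univ Y ∧ AnalyticAt ℂ Y z₀ ∧ Y z₀ = α ∧
      deriv Y z₀ = β := by
  refine exists_meromorphic_solution_of_energy ?_ z₀ α β
    (energy 1 fun z w => 4 * w ^ 3 + 2 * z * w) ?_ painleveOne_uniform_local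
  · unfold Function.uncurry painleveOneRHS
    fun_prop
  · refine energy_bounded (Qz := fun _ w => 2 * w) 1 (fun f z hf => ?_)
      painleveOne_energy_growth z₀ α β
    have h1 := hf.hasDerivAt
    have h2 := ((h1.pow 3).const_mul 4).add (((hasDerivAt_id' z).const_mul 2).mul h1)
    refine h2.congr_deriv ?_
    simp only [painleveOneRHS]
    push_cast
    ring

/-- Near infinity, bounded energy means bounded coordinates in one of the pole charts of
`y'' = 2 y³ + (p z + q) y + a`. -/
lemma painleveTwo_chart_bound {p q a σ : ℂ} (hσ : σ ^ 2 = 1) {T M : ℝ} {z w v u : ℂ}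
    (hz : ‖p * z + q‖ ≤ T)
    (hE : ‖energy p (fun z w => w ^ 4 + (p * z + q) * w ^ 2 + 2 * a * w) z w v‖ ≤ M)
    (hu0 : u ≠ 0) (hu1 : ‖u‖ ≤ 1) (hpu : ‖p‖ * ‖u‖ ≤ 1 / 2) (hw : w * u = 1)
    (hsign : ‖v - σ * w ^ 2‖ ≤ ‖v + σ * w ^ 2‖) :
    ∃ b, ‖b‖ ≤ (2 * (M + ‖p‖ + T + 2 * ‖a‖)) ^ 2 + 2 * ‖p‖ * (2 * (M + ‖p‖ + T + 2 * ‖a‖)) +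
        M + ‖p‖ ∧
      v = σ * ((u ^ 2)⁻¹ + (p * z + q) / 2) + (σ * a - p / 2) * u + b * u ^ 2 := by
  have hM : 0 ≤ M := (norm_nonneg _).trans hE
  have hT : 0 ≤ T := (norm_nonneg _).trans hz
  set τ := p * z + q with hτ
  set E := energy p (fun z w => w ^ 4 + (p * z + q) * w ^ 2 + 2 * a * w) z w v with hEdef
  have hE' : E = v ^ 2 + p * smoothInv w * v - w ^ 4 - τ * w ^ 2 - 2 * a * w := by
    rw [hEdef, energy]; simp only [← hτ]; ring
  have hσn : ‖σ‖ = 1 := by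
    have h1 : ‖σ‖ ^ 2 = 1 := by rw [← norm_pow, hσ, norm_one]
    exact (pow_eq_one_iff_of_nonneg (norm_nonneg σ) two_ne_zero).1 h1
  set P := v - σ * w ^ 2 with hP
  have hw' : w = u⁻¹ := eq_inv_of_mul_eq_one_left hw
  have hs : ‖cutoff w‖ ≤ ‖u‖ ^ 2 := norm_cutoff_le_of_mul_eq_one hw
  have hχu : ‖p * smoothInv w‖ ≤ 1 / 2 := by
    have h1 : ‖w‖ * ‖u‖ = 1 := by rw [← norm_mul, hw, norm_one]
    rw [norm_mul, norm_smoothInv]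
    calc ‖p‖ * (‖w‖ * ‖cutoff w‖) ≤ ‖p‖ * (‖w‖ * ‖u‖ ^ 2) := by gcongr
      _ = ‖p‖ * ‖u‖ * (‖w‖ * ‖u‖) := by ring
      _ ≤ 1 / 2 := by rw [h1, mul_one]; exact hpu
  have hχ : ‖p * smoothInv w‖ ≤ ‖p‖ := by
    rw [norm_mul]
    exact mul_le_of_le_one_right (norm_nonneg p) (norm_smoothInv_le_one w)
  have hu2 : ‖u‖ ^ 2 ≤ 1 := pow_le_one₀ (norm_nonneg u) hu1
  have hfac : 1 ≤ ‖P * u ^ 2 + 2 * σ‖ := by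
    have e1 : P * u ^ 2 + 2 * σ = (v + σ * w ^ 2) * u ^ 2 := by rw [hP, hw']; field_simp; ring
    have h1 : ‖P * u ^ 2‖ ≤ ‖P * u ^ 2 + 2 * σ‖ := by
      rw [e1, norm_mul, norm_mul]
      gcongr
    have h2 : (2 : ℝ) ≤ ‖P * u ^ 2 + 2 * σ‖ + ‖P * u ^ 2‖ := by
      have := norm_sub_le (P * u ^ 2 + 2 * σ) (P * u ^ 2)
      rwa [add_sub_cancel_left, norm_mul, Complex.norm_two, hσn, mul_one] at this
    linarith
  set D := 2 * (M + ‖p‖ + T + 2 * ‖a‖) with hD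
  have hPb : ‖P‖ ≤ D := by
    have hid : P * (P * u ^ 2 + 2 * σ) = E * u ^ 2 - p * smoothInv w * (P * u ^ 2)
        - p * smoothInv w * σ + τ + 2 * a * u := by
      rw [hE', hP, hw']
      field_simp
      linear_combination (-1 : ℂ) * hσ
    have h1 : ‖P‖ * ‖P * u ^ 2 + 2 * σ‖ ≤
        M * 1 + 1 / 2 * (‖P‖ * 1) + ‖p‖ * 1 + T + 2 * ‖a‖ * 1 := by
      rw [← norm_mul, hid]
      refine (norm_add_le _ _).trans (add_le_add ((norm_add_le _ _).trans (add_le_add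
        ((norm_sub_le _ _).trans (add_le_add ((norm_sub_le _ _).trans (add_le_add ?_ ?_)) ?_))
        hz)) ?_)
      · rw [norm_mul, norm_pow]; gcongr
      · rw [norm_mul, norm_mul P, norm_pow]; gcongr
      · rw [norm_mul, hσn]; gcongr
      · rw [norm_mul, norm_mul, Complex.norm_two]; gcongr
    nlinarith [norm_nonneg P]
  have hD0 : 0 ≤ D := by positivity
  refine ⟨(P - σ * τ / 2 - (σ * a - p / 2) * u) / u ^ 2, ?_, ?_⟩
  · set b := (P - σ * τ / 2 - (σ * a - p / 2) * u) / u ^ 2 with hb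
    have hid : 2 * (σ * b) = E + p * ((P * u ^ 2 + σ) * (cutoff w * (u ^ 2)⁻¹ * u)) -
        P ^ 2 - p * P * u := by
      rw [hE', hb, smoothInv_eq_of_mul_eq_one hw, hP, hw']
      field_simp
      linear_combination -(1 + τ * u ^ 2 + 2 * a * u ^ 3) * hσ
    have hcu : ‖cutoff w * (u ^ 2)⁻¹ * u‖ ≤ 1 := by
      have hupos : 0 < ‖u‖ := norm_pos_iff.2 hu0
      rw [norm_mul, norm_mul, norm_inv, norm_pow]
      calc ‖cutoff w‖ * (‖u‖ ^ 2)⁻¹ * ‖u‖ ≤ ‖u‖ ^ 2 * (‖u‖ ^ 2)⁻¹ * ‖u‖ := by gcongr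
        _ = ‖u‖ := by field_simp
        _ ≤ 1 := hu1
    have h4 : 2 * ‖b‖ ≤ M + ‖p‖ * ((D * 1 + 1) * 1) + D ^ 2 + ‖p‖ * D * 1 := by
      have : 2 * ‖b‖ = ‖2 * (σ * b)‖ := by rw [norm_mul, norm_mul, hσn, Complex.norm_two, one_mul]
      rw [this, hid]
      refine (norm_sub_le _ _).trans (add_le_add ((norm_sub_le _ _).trans (add_le_add
        ((norm_add_le _ _).trans (add_le_add hE ?_)) ?_)) ?_)
      · rw [norm_mul, norm_mul (P * u ^ 2 + σ)]
        gcongr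
        refine (norm_add_le _ _).trans ?_
        rw [norm_mul, norm_pow, hσn]
        gcongr
      · rw [norm_pow]; gcongr
      · rw [norm_mul, norm_mul]; gcongr
    nlinarith [norm_nonneg b, norm_nonneg p, mul_nonneg (norm_nonneg p) hD0, sq_nonneg D]
  · rw [hP, hw']
    field_simp
    ring

/-- Initial data of `y'' = 2 y³ + (p z + q) y + a` with bounded energy have meromorphic solutions
on discs of a uniform radius. -/
lemma painleveTwo_uniform_local (p q a : ℂ) (R M : ℝ) :
    ∃ δ > 0, ∀ z w v : ℂ, ‖z‖ ≤ R →
      ‖energy p (fun z w => w ^ 4 + (p * z + q) * w ^ 2 + 2 * a * w) z w v‖ ≤ M →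
      ∃ g, IsMeromorphicSolutionOn (fun z w => 2 * w ^ 3 + (p * z + q) * w + a)
        (Metric.ball z δ) g ∧ AnalyticAt ℂ g z ∧ g z = w ∧ deriv g z = v := by
  set T := ‖p‖ * R + ‖q‖ with hT
  set L := 1 + 2 * ‖p‖ with hL
  set B := (2 * (M + ‖p‖ + T + 2 * ‖a‖)) ^ 2 + 2 * ‖p‖ * (2 * (M + ‖p‖ + T + 2 * ‖a‖)) +
        M + ‖p‖ with hB
  set N := 1 + (2 * M + ‖p‖ ^ 2 + 2 * (L ^ 4 + T * L ^ 2 + 2 * ‖a‖ * L)) with hN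
  have hL1 : 1 ≤ L := by rw [hL]; linarith [norm_nonneg p]
  obtain ⟨δ₁, hδ₁, H₁⟩ := exists_uniform_analytic_solution
    (F := fun z w => 2 * w ^ 3 + (p * z + q) * w + a)
    (.C 2 * .X 1 ^ 3 + (.C p * .X 0 + .C q) * .X 1 + .C a) (fun x => by simp)
    (max R (max L N))
  obtain ⟨δ₂, hδ₂, H₂⟩ := painleveTwo_pole_chart p q a 1 (by norm_num) (max R (max 1 B))
  obtain ⟨δ₃, hδ₃, H₃⟩ := painleveTwo_pole_chart p q a (-1) (by norm_num) (max R (max 1 B))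
  refine ⟨min δ₁ (min δ₂ δ₃), lt_min hδ₁ (lt_min hδ₂ hδ₃), fun z w v hz hE => ?_⟩
  have hτ : ‖p * z + q‖ ≤ T := by
    refine (norm_add_le _ _).trans ?_
    rw [norm_mul, hT]
    gcongr
  have hT0 : 0 ≤ T := (norm_nonneg _).trans hτ
  rcases le_or_gt ‖w‖ L with hw | hw
  · have hv : ‖v‖ ≤ N := by
      have h1 := sq_norm_le_of_energy p
        (fun z w => w ^ 4 + (p * z + q) * w ^ 2 + 2 * a * w) z w v
      have h2 : ‖w ^ 4 + (p * z + q) * w ^ 2 + 2 * a * w‖ ≤ L ^ 4 + T * L ^ 2 + 2 * ‖a‖ * L := by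
        refine norm_add₃_le.trans ?_
        rw [norm_mul, norm_mul, norm_mul, norm_pow, norm_pow, Complex.norm_two]
        gcongr
      rw [hN]
      nlinarith [sq_nonneg (‖v‖ - 1)]
    obtain ⟨g, hg, h⟩ := H₁ z w v (hz.trans (le_max_left _ _))
      (hw.trans ((le_max_left _ _).trans (le_max_right _ _)))
      (hv.trans ((le_max_right _ _).trans (le_max_right _ _)))
    exact ⟨g, hg.mono (Metric.ball_subset_ball (min_le_left _ _)), h⟩
  · have hw0 : w ≠ 0 := by rintro rfl; simp at hw; linarith
    have hwu : w * w⁻¹ = 1 := mul_inv_cancel₀ hw0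
    have hwpos : 0 < ‖w‖ := norm_pos_iff.2 hw0
    have hu0 : w⁻¹ ≠ 0 := inv_ne_zero hw0
    have hu1 : ‖w⁻¹‖ ≤ 1 := by
      rw [norm_inv]
      exact inv_le_one_of_one_le₀ (hL1.trans hw.le)
    have hpu : ‖p‖ * ‖w⁻¹‖ ≤ 1 / 2 := by
      rw [norm_inv, ← div_eq_mul_inv, div_le_iff₀ hwpos]
      linarith
    have hz' : ‖z‖ ≤ max R (max 1 B) := hz.trans (le_max_left _ _)
    have hu' : ‖w⁻¹‖ ≤ max R (max 1 B) := hu1.trans ((le_max_left _ _).trans (le_max_right _ _))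
    have hb' : B ≤ max R (max 1 B) := (le_max_right _ _).trans (le_max_right _ _)
    rcases le_total ‖v - 1 * w ^ 2‖ ‖v + 1 * w ^ 2‖ with h | h
    · obtain ⟨b, hb, hvb⟩ := painleveTwo_chart_bound (by norm_num) hτ hE hu0 hu1 hpu hwu h
      obtain ⟨g, hg, hga, hg0, hg1⟩ := H₂ z w⁻¹ b hz' hu' (hb.trans hb') hu0
      exact ⟨g, hg.mono (Metric.ball_subset_ball ((min_le_right _ _).trans (min_le_left _ _))),
        hga, by rw [hg0, inv_inv], by rw [hg1, ← hvb]⟩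
    · have h' : ‖v - -1 * w ^ 2‖ ≤ ‖v + -1 * w ^ 2‖ := by
        have e1 : v - -1 * w ^ 2 = v + 1 * w ^ 2 := by ring
        have e2 : v + -1 * w ^ 2 = v - 1 * w ^ 2 := by ring
        rwa [e1, e2]
      obtain ⟨b, hb, hvb⟩ := painleveTwo_chart_bound (by norm_num) hτ hE hu0 hu1 hpu hwu h'
      obtain ⟨g, hg, hga, hg0, hg1⟩ := H₃ z w⁻¹ b hz' hu' (hb.trans hb') hu0
      exact ⟨g, hg.mono (Metric.ball_subset_ball ((min_le_right _ _).trans (min_le_right _ _))),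
        hga, by rw [hg0, inv_inv], by rw [hg1, ← hvb]⟩

/-- **Painlevé property of the second Painlevé equation**, in a form with an affine change of the
independent variable built in. -/
theorem painleveTwo_exists_meromorphic (p q a z₀ α β : ℂ) :
    ∃ Y, IsMeromorphicSolutionOn (fun z w => 2 * w ^ 3 + (p * z + q) * w + a) univ Y ∧
      AnalyticAt ℂ Y z₀ ∧ Y z₀ = α ∧ deriv Y z₀ = β := by
  refine exists_meromorphic_solution_of_energy ?_ z₀ α β
    (energy p fun z w => w ^ 4 + (p * z + q) * w ^ 2 + 2 * a * w) ?_
    (painleveTwo_uniform_local p q a)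
  · unfold Function.uncurry
    fun_prop
  · refine energy_bounded (Qz := fun _ w => p * w ^ 2) p (fun f z hf => ?_)
      (painleveTwo_energy_growth p q a) z₀ α β
    have h1 := hf.hasDerivAt
    have h2 := ((h1.pow 4).add ((((hasDerivAt_id' z).const_mul p).add_const q).mul
      (h1.pow 2))).add (h1.const_mul (2 * a))
    refine h2.congr_deriv ?_
    simp only [Pi.pow_apply]
    push_cast
    ring

/-- The Painlevé property of `y'' = 6 y² + z + ε⁶ (2 y³ + z y)`. For `ε ≠ 0` the substitution
`w = ε³ y + ε⁻³` leads to `w'' = 2 w³ + (ε⁶ z - 6 ε⁻⁶) w + 4 ε⁻⁹`. -/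
theorem painleveTwoRHS_exists_meromorphic (ε z₀ α β : ℂ) :
    ∃ Y, IsMeromorphicSolutionOn (painleveTwoRHS ε) univ Y ∧ AnalyticAt ℂ Y z₀ ∧ Y z₀ = α ∧
      deriv Y z₀ = β := by
  by_cases hε : ε = 0
  · have h : painleveTwoRHS ε = painleveOneRHS := by
      funext z w
      simp [painleveTwoRHS, painleveOneRHS, hε]
    rw [h]
    exact painleveOne_exists_meromorphic z₀ α β
  set e := ε ^ 3 with he
  have he0 : e ≠ 0 := pow_ne_zero 3 hε
  obtain ⟨Y, hY, hYa, hY0, hY1⟩ := painleveTwo_exists_meromorphic (e ^ 2) (-6 / e ^ 2) (4 / e ^ 3)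
    z₀ (e * α + 1 / e) (e * β)
  set g : ℂ → ℂ := fun z => e⁻¹ * (Y z - 1 / e) with hg
  have hgm : MeromorphicOn g univ := fun z hz =>
    (MeromorphicAt.const _ z).mul ((hY.nf hz).meromorphicAt.sub (.const _ z))
  have hgana : ∀ z, AnalyticAt ℂ Y z → AnalyticAt ℂ g z := fun z hz =>
    analyticAt_const.mul (hz.sub analyticAt_const)
  have hgd : ∀ z, AnalyticAt ℂ Y z → deriv g z = e⁻¹ * deriv Y z := fun z hz =>
    ((hz.differentiableAt.hasDerivAt.sub_const (1 / e)).const_mul e⁻¹).deriv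
  have hgdd : ∀ z, AnalyticAt ℂ Y z → deriv (deriv g) z = e⁻¹ * deriv (deriv Y) z := by
    intro z hz
    have h1 : deriv g =ᶠ[𝓝 z] fun z => e⁻¹ * deriv Y z := by
      filter_upwards [hz.eventually_analyticAt] with x hx using hgd x hx
    rw [h1.deriv_eq]
    exact (hz.deriv.differentiableAt.hasDerivAt.const_mul e⁻¹).deriv
  have hsol : IsMeromorphicSolutionOn (painleveTwoRHS ε) univ (toMeromorphicNFOn g univ) := by
    refine .toMeromorphicNFOn hgm ?_ fun z hz => ?_
    · unfold Function.uncurry painleveTwoRHS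
      fun_prop
    · filter_upwards [(hY.nf hz).meromorphicAt.eventually_analyticAt] with x hx
      rw [hgdd x hx, hY.ode x (mem_univ x) hx, painleveTwoRHS, hg,
        show ε ^ 6 = e ^ 2 by rw [he]; ring]
      field_simp
      ring
  have heq : toMeromorphicNFOn g univ =ᶠ[𝓝 z₀] g :=
    ((meromorphicNFOn_toMeromorphicNFOn g _ (mem_univ z₀)).eventuallyEq_nhdsNE_iff_eventuallyEq_nhds
      (hgana z₀ hYa).meromorphicNFAt).1 (hgm.toMeromorphicNFOn_eq_self_on_nhdsNE (mem_univ z₀))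
  refine ⟨_, hsol, (hgana z₀ hYa).congr heq.symm, ?_, ?_⟩
  · rw [heq.eq_of_nhds, hg]
    simp only [hY0]
    field_simp
    ring
  · rw [heq.deriv_eq, hgd z₀ hYa, hY1]
    field_simp

/-! ### Maximal solutions and dependence on the parameter -/

/-- A maximally extended solution whose germ continues meromorphically to the plane lives exactly
on the complement of the poles, and equals the meromorphic solution there. -/
lemma IsMaximalAnalyticSolution.eq_meromorphic {F : ℂ → ℂ → ℂ}
    (hF : ContDiff ℂ 1 (Function.uncurry F)) {z₀ α β : ℂ} {U : Set ℂ} {f Y : ℂ → ℂ}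
    (hf : IsMaximalAnalyticSolution F z₀ α β U f) (hY : IsMeromorphicSolutionOn F univ Y)
    (hYa : AnalyticAt ℂ Y z₀) (hY0 : Y z₀ = α) (hY1 : deriv Y z₀ = β) :
    U = {z | AnalyticAt ℂ Y z} ∧ EqOn f Y U := by
  have hs := hf.isSolution
  have hloc : ∀ x ∈ U, f =ᶠ[𝓝 x] Y :=
    (isMeromorphicSolutionOn_of_analyticOnNhd hs.analytic hs.ode).eventuallyEq
      (hY.mono (subset_univ U)) hF hs.isOpen hs.isConnected.isPreconnected hs.mem
      (hs.analytic z₀ hs.mem) hYa (by rw [hs.initial_value, hY0])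
      (by rw [hs.initial_deriv, hY1])
  have heq : EqOn f Y U := fun x hx => (hloc x hx).eq_of_nhds
  refine ⟨(hf.maximal {z | AnalyticAt ℂ Y z} Y ?_
    (fun x hx => (hs.analytic x hx).congr (hloc x hx)) heq.symm).symm, heq⟩
  have hcount : {z | AnalyticAt ℂ Y z}ᶜ.Countable :=
    Meromorphic.countable_compl_analyticAt fun z => (hY.nf (mem_univ z)).meromorphicAt
  refine ⟨isOpen_analyticAt ℂ Y, ?_, hYa, fun z hz => hz, fun z hz => hY.ode z (mem_univ z) hz,
    hY0, hY1⟩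
  have := hcount.isConnected_compl_of_one_lt_rank
    (by rw [Complex.rank_real_complex]; exact Nat.one_lt_ofNat)
  rwa [compl_compl] at this

/-- If a maximally extended solution is the restriction of a meromorphic solution in the plane,
then its domain contains every connected domain on which an analytic solution with the same
data exists. -/
lemma subset_and_eqOn_of_analytic_solution {F : ℂ → ℂ → ℂ}
    (hF : ContDiff ℂ 1 (Function.uncurry F)) {U B : Set ℂ} {f Y g : ℂ → ℂ} (hUo : IsOpen U)
    (hY : IsMeromorphicSolutionOn F univ Y) (hU : U = {z | AnalyticAt ℂ Y z}) (hfY : EqOn f Y U)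
    (hBo : IsOpen B) (hB : IsPreconnected B) (hg : AnalyticOnNhd ℂ g B)
    (hode : ∀ z ∈ B, deriv (deriv g) z = F z (g z)) {c : ℂ} (hcB : c ∈ B) (hcU : c ∈ U)
    (h0 : f c = g c) (h1 : deriv f c = deriv g c) : B ⊆ U ∧ EqOn f g B := by
  have hfYc : f =ᶠ[𝓝 c] Y := hfY.eventuallyEq_of_mem (hUo.mem_nhds hcU)
  have hloc : ∀ x ∈ B, Y =ᶠ[𝓝 x] g := by
    refine (hY.mono (subset_univ B)).eventuallyEq
      (isMeromorphicSolutionOn_of_analyticOnNhd hg hode) hF hBo hB hcB ?_ (hg c hcB) ?_ ?_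
    · rw [hU] at hcU; exact hcU
    · rw [← hfYc.eq_of_nhds, h0]
    · rw [← hfYc.deriv_eq, h1]
  have hsub : B ⊆ U := by
    intro x hx
    rw [hU]
    exact (hg x hx).congr (hloc x hx).symm
  exact ⟨hsub, fun x hx => (hfY (hsub hx)).trans (hloc x hx).eq_of_nhds⟩

lemma contDiff_painleveTwoRHS (ε : ℂ) : ContDiff ℂ 1 (Function.uncurry (painleveTwoRHS ε)) := by
  unfold Function.uncurry painleveTwoRHS
  fun_prop

/-- **Propagation of analytic dependence.** Near given initial data for `ε = 0` there is a uniform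
radius `ρ` such that solutions whose data at a point `c` depend analytically on `ε` are jointly
analytic in `(z, ε)` for `|z - c| < ρ` and small `ε`. -/
lemma exists_radius_analytic_dependence {U : ℂ → Set ℂ} {y Y : ℂ → ℂ → ℂ}
    (hUo : ∀ ε, IsOpen (U ε)) (hY : ∀ ε, IsMeromorphicSolutionOn (painleveTwoRHS ε) univ (Y ε))
    (hU : ∀ ε, U ε = {z | AnalyticAt ℂ (Y ε) z}) (hyY : ∀ ε, EqOn (y ε) (Y ε) (U ε))
    (z₁ w₁ v₁ : ℂ) :
    ∃ ρ > 0, ∀ c ∈ Metric.ball z₁ ρ, ∀ W V : ℂ → ℂ, AnalyticAt ℂ W 0 → AnalyticAt ℂ V 0 →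
      W 0 ∈ Metric.ball w₁ ρ → V 0 ∈ Metric.ball v₁ ρ →
      (∀ᶠ ε in 𝓝 0, c ∈ U ε ∧ y ε c = W ε ∧ deriv (y ε) c = V ε) →
      ∀ z ∈ Metric.ball c ρ, ∀ᶠ x : ℂ × ℂ in 𝓝 (z, 0),
        x.1 ∈ U x.2 ∧ AnalyticAt ℂ (fun x : ℂ × ℂ => y x.2 x.1) x := by
  obtain ⟨δ, hδ, Φ, hΦana, hΦ⟩ := exists_analytic_local_flow
    (![1, .X 2, .C 6 * .X 1 ^ 2 + .X 0 + .X 3 ^ 6 * (.C 2 * .X 1 ^ 3 + .X 0 * .X 1), 0] :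
      Fin 4 → MvPolynomial (Fin 4) ℂ) ![z₁, w₁, v₁, 0]
  refine ⟨δ, hδ, fun c hc W V hW hV hW0 hV0 hdata z hz => ?_⟩
  set P : ℂ → Fin 4 → ℂ := fun ε => ![c, W ε, V ε, ε] with hP
  have hPana : ∀ ε, AnalyticAt ℂ W ε → AnalyticAt ℂ V ε → AnalyticAt ℂ P ε := by
    intro ε h1 h2
    refine (analyticAt_pi_iff (f := fun i ε => P ε i)).2 fun i => ?_
    fin_cases i
    · exact analyticAt_const
    · exact h1
    · exact h2
    · exact analyticAt_id
  have hP0 : P 0 ∈ Metric.ball ![z₁, w₁, v₁, 0] δ := by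
    rw [Metric.mem_ball, dist_pi_lt_iff hδ]
    intro i
    fin_cases i
    · exact hc
    · exact hW0
    · exact hV0
    · simpa [hP] using hδ
  obtain ⟨r, hr, H⟩ := Metric.eventually_nhds_iff_ball.1
    (hdata.and ((hW.eventually_analyticAt.and hV.eventually_analyticAt).and
      ((hPana 0 hW hV).continuousAt.eventually_mem (Metric.isOpen_ball.mem_nhds hP0))))
  have hmem : ∀ x ∈ Metric.ball c δ, x - c ∈ Metric.ball (0 : ℂ) δ := fun x hx => by
    rwa [mem_ball_zero_iff, ← dist_eq_norm]
  have hc' : c ∈ Metric.ball c δ := Metric.mem_ball_self hδ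
  have key : ∀ ε ∈ Metric.ball (0 : ℂ) r, Metric.ball c δ ⊆ U ε ∧
      EqOn (y ε) (fun x => Φ (x - c, P ε) 1) (Metric.ball c δ) := by
    intro ε hε
    obtain ⟨⟨hcU, hyc, hdyc⟩, -, hPε⟩ := H ε hε
    obtain ⟨hΦ0, hΦd⟩ := hΦ (P ε) hPε
    have hd := fun h hh => hasDerivAt_pi.1 (hΦd h hh)
    have e0 : ∀ h ∈ Metric.ball (0 : ℂ) δ, Φ (h, P ε) 0 = c + h := by
      intro h hh
      rw [eq_add_of_hasDerivAt_one (x := fun h => Φ (h, P ε) 0)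
        (fun h hh => by simpa using hd h hh 0) h hh, hΦ0]
      simp [hP]
    have e3 : ∀ h ∈ Metric.ball (0 : ℂ) δ, Φ (h, P ε) 3 = ε := by
      intro h hh
      have h3 : ∀ h ∈ Metric.ball (0 : ℂ) δ, HasDerivAt (fun h => Φ (h, P ε) 3) 0 h :=
        fun h hh => by simpa using hd h hh 3
      have := Metric.isOpen_ball.is_const_of_deriv_eq_zero (convex_ball (0 : ℂ) δ).isPreconnected
        (fun k hk => (h3 k hk).differentiableAt.differentiableWithinAt)
        (fun k hk => (h3 k hk).deriv) hh (Metric.mem_ball_self hδ)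
      rw [this, hΦ0]
      simp [hP]
    have d1 : ∀ x ∈ Metric.ball c δ,
        HasDerivAt (fun x => Φ (x - c, P ε) 1) (Φ (x - c, P ε) 2) x := by
      intro x hx
      have := hd _ (hmem x hx) 1
      simp only [Matrix.cons_val, MvPolynomial.eval_X] at this
      exact this.comp_sub_const x c
    have d2 : ∀ x ∈ Metric.ball c δ, HasDerivAt (fun x => Φ (x - c, P ε) 2)
        (painleveTwoRHS ε x (Φ (x - c, P ε) 1)) x := by
      intro x hx
      have := hd _ (hmem x hx) 2
      simp only [Matrix.cons_val, map_add, map_mul, map_pow, MvPolynomial.eval_C,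
        MvPolynomial.eval_X, e0 _ (hmem x hx), e3 _ (hmem x hx), add_sub_cancel] at this
      exact this.comp_sub_const x c
    refine subset_and_eqOn_of_analytic_solution (contDiff_painleveTwoRHS ε) (hUo ε) (hY ε) (hU ε)
      (hyY ε) Metric.isOpen_ball (convex_ball c δ).isPreconnected
      (DifferentiableOn.analyticOnNhd
        (fun x hx => (d1 x hx).differentiableAt.differentiableWithinAt) Metric.isOpen_ball)
      (fun x hx => ?_) hc' hcU ?_ ?_
    · have he : deriv (fun x => Φ (x - c, P ε) 1) =ᶠ[𝓝 x] fun x => Φ (x - c, P ε) 2 := by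
        filter_upwards [Metric.isOpen_ball.mem_nhds hx] with t ht using (d1 t ht).deriv
      rw [he.deriv_eq, (d2 x hx).deriv]
    · rw [hyc, sub_self, hΦ0]
      rfl
    · rw [(d1 c hc').deriv, hdyc, sub_self, hΦ0]
      rfl
  have hopen : IsOpen (Metric.ball c δ ×ˢ Metric.ball (0 : ℂ) r) :=
    Metric.isOpen_ball.prod Metric.isOpen_ball
  filter_upwards [hopen.mem_nhds ⟨hz, Metric.mem_ball_self hr⟩] with x hx
  refine ⟨(key x.2 hx.2).1 hx.1, ?_⟩
  have heq : (fun x : ℂ × ℂ => Φ (x.1 - c, P x.2) 1) =ᶠ[𝓝 x] fun x : ℂ × ℂ => y x.2 x.1 := by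
    filter_upwards [hopen.mem_nhds hx] with t ht using ((key t.2 ht.2).2 ht.1).symm
  refine AnalyticAt.congr ?_ heq
  obtain ⟨-, ⟨hWx, hVx⟩, hPx⟩ := H x.2 hx.2
  have h1 : AnalyticAt ℂ Φ (x.1 - c, P x.2) := hΦana _ ⟨hmem _ hx.1, hPx⟩
  have h2 : AnalyticAt ℂ (fun p => Φ p 1) (x.1 - c, P x.2) :=
    (analyticAt_pi_iff (f := fun i p => Φ p i)).1 h1 1
  exact h2.comp (f := fun x : ℂ × ℂ => (x.1 - c, P x.2))
    ((analyticAt_fst.sub analyticAt_const).prod ((hPana _ hWx hVx).comp analyticAt_snd))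

/-- The domains and the joint analyticity persist near every point of the domain of the limiting
solution. -/
lemma eventually_mem_and_analyticAt {z₀ α β : ℂ} {U : ℂ → Set ℂ} {y : ℂ → ℂ → ℂ}
    (hy : ∀ ε, IsMaximalAnalyticSolution (painleveTwoRHS ε) z₀ α β (U ε) (y ε)) :
    ∀ z ∈ U 0, ∀ᶠ x : ℂ × ℂ in 𝓝 (z, 0),
      x.1 ∈ U x.2 ∧ AnalyticAt ℂ (fun x : ℂ × ℂ => y x.2 x.1) x := by
  choose Y hY hYa hY0 hY1 using fun ε => painleveTwoRHS_exists_meromorphic ε z₀ α β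
  have hUY := fun ε => (hy ε).eq_meromorphic (contDiff_painleveTwoRHS ε) (hY ε) (hYa ε) (hY0 ε)
    (hY1 ε)
  have hrad := exists_radius_analytic_dependence (fun ε => (hy ε).isSolution.isOpen) hY
    (fun ε => (hUY ε).1) (fun ε => (hUY ε).2)
  set A : Set ℂ := {z | ∀ᶠ x : ℂ × ℂ in 𝓝 (z, 0),
    x.1 ∈ U x.2 ∧ AnalyticAt ℂ (fun x : ℂ × ℂ => y x.2 x.1) x} with hA
  have hAo : IsOpen A := by
    rw [isOpen_iff_eventually]
    intro z hz
    have ht : Tendsto (fun z : ℂ => (z, (0 : ℂ))) (𝓝 z) (𝓝 (z, 0)) :=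
      (Continuous.prodMk_left (0 : ℂ)).continuousAt
    exact ht.eventually (eventually_eventually_nhds.2 hz)
  have hz₀A : z₀ ∈ A := by
    obtain ⟨ρ, hρ, H⟩ := hrad z₀ α β
    have hb : ∀ a : ℂ, a ∈ Metric.ball a ρ := fun a => Metric.mem_ball_self hρ
    exact H z₀ (hb _) (fun _ => α) (fun _ => β) analyticAt_const analyticAt_const (hb _) (hb _)
      (.of_forall fun ε => ⟨(hy ε).isSolution.mem, (hy ε).isSolution.initial_value,
        (hy ε).isSolution.initial_deriv⟩) z₀ (hb _)
  refine (hy 0).isSolution.isConnected.isPreconnected.subset_of_closure_inter_subset hAo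
    ⟨z₀, (hy 0).isSolution.mem, hz₀A⟩ ?_
  rintro z₁ ⟨hcl, hz₁⟩
  obtain ⟨ρ, hρ, H⟩ := hrad z₁ (y 0 z₁) (deriv (y 0) z₁)
  have hyan := (hy 0).isSolution.analytic z₁ hz₁
  have hnear : ∀ᶠ c in 𝓝 z₁, c ∈ Metric.ball z₁ ρ ∧ y 0 c ∈ Metric.ball (y 0 z₁) ρ ∧
      deriv (y 0) c ∈ Metric.ball (deriv (y 0) z₁) ρ :=
    (show ∀ᶠ c in 𝓝 z₁, c ∈ Metric.ball z₁ ρ from Metric.ball_mem_nhds z₁ hρ).and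
      ((hyan.continuousAt.eventually_mem (Metric.ball_mem_nhds _ hρ)).and
        (hyan.deriv.continuousAt.eventually_mem (Metric.ball_mem_nhds _ hρ)))
  obtain ⟨c, hcA, hc, hc0, hc1⟩ := (mem_closure_iff_frequently.1 hcl).and_eventually hnear |>.exists
  have hε : Tendsto (fun ε : ℂ => (c, ε)) (𝓝 0) (𝓝 (c, 0)) :=
    (Continuous.prodMk_right c).continuousAt
  have hev := hε.eventually hcA
  have han : AnalyticAt ℂ (fun x : ℂ × ℂ => y x.2 x.1) (c, 0) := (Filter.Eventually.self_of_nhds hcA).2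
  -- the derivative in `z` is a partial derivative of the jointly analytic function
  have hder : ∀ᶠ ε in 𝓝 (0 : ℂ), deriv (y ε) c =
      fderiv ℂ (fun x : ℂ × ℂ => y x.2 x.1) (c, ε) (1, 0) := by
    filter_upwards [hev] with ε h
    have h1 := h.2.differentiableAt.hasFDerivAt
    have h2 : HasDerivAt (fun z : ℂ => (z, ε)) ((1 : ℂ), (0 : ℂ)) c :=
      (hasDerivAt_id c).prodMk (hasDerivAt_const c ε)
    exact (h1.comp_hasDerivAt c h2).deriv
  have hWan : AnalyticAt ℂ (fun ε => y ε c) 0 :=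
    han.comp (f := fun ε : ℂ => (c, ε)) (analyticAt_const.prod analyticAt_id)
  have hVan : AnalyticAt ℂ
      (fun ε => fderiv ℂ (fun x : ℂ × ℂ => y x.2 x.1) (c, ε) (1, 0)) 0 :=
    ((ContinuousLinearMap.apply ℂ ℂ ((1 : ℂ), (0 : ℂ))).analyticAt _).comp
      (han.fderiv.comp (f := fun ε : ℂ => (c, ε)) (analyticAt_const.prod analyticAt_id))
  refine H c hc _ _ hWan hVan hc0 ?_ ?_ z₁ (by rwa [Metric.mem_ball, dist_comm])
  · rw [← hder.self_of_nhds]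
    exact hc1
  · filter_upwards [hev, hder] with ε h1 h2
    exact ⟨h1.1, rfl, h2⟩

theorem mainTheorem2 (z₀ α β : ℂ)
    (Ω : Set ℂ) (yI : ℂ → ℂ)
    (hyI : IsMaximalAnalyticSolution painleveOneRHS z₀ α β Ω yI)
    (U : ℂ → Set ℂ) (y : ℂ → ℂ → ℂ)
    (hy : ∀ ε : ℂ, IsMaximalAnalyticSolution (painleveTwoRHS ε) z₀ α β (U ε) (y ε))
    (K : Set ℂ) (hK : IsCompact K) (hKΩ : K ⊆ Ω) :
    (∃ r : ℝ, 0 < r ∧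
      (∀ ε ∈ Metric.ball (0 : ℂ) r, K ⊆ U ε) ∧
      AnalyticOnNhd ℂ (fun p : ℂ × ℂ => y p.2 p.1) (K ×ˢ Metric.ball (0 : ℂ) r)) ∧
    TendstoUniformlyOn y yI (𝓝 (0 : ℂ)) K := by
  -- for `ε = 0` the second family gives back the first equation
  have h0 : painleveTwoRHS 0 = painleveOneRHS := by
    funext z w
    simp [painleveTwoRHS, painleveOneRHS]
  rw [← h0] at hyI
  obtain ⟨Y, hY, hYa, hY0, hY1⟩ := painleveTwoRHS_exists_meromorphic 0 z₀ α β
  obtain ⟨hΩ, hyIY⟩ := hyI.eq_meromorphic (contDiff_painleveTwoRHS 0) hY hYa hY0 hY1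
  obtain ⟨hU0, hyY⟩ := (hy 0).eq_meromorphic (contDiff_painleveTwoRHS 0) hY hYa hY0 hY1
  have hΩU : Ω = U 0 := hΩ.trans hU0.symm
  have hKU : K ⊆ U 0 := hΩU ▸ hKΩ
  have hyI0 : ∀ z ∈ K, yI z = y 0 z := fun z hz =>
    (hyIY (hKΩ hz)).trans (hyY (hKU hz)).symm
  have hloc := eventually_mem_and_analyticAt hy
  have hswap : ∀ z : ℂ, Tendsto (Prod.swap : ℂ × ℂ → ℂ × ℂ) (𝓝 (0, z)) (𝓝 (z, 0)) := fun z =>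
    continuous_swap.continuousAt
  constructor
  · have hev := hK.eventually_forall_of_forall_eventually (x₀ := (0 : ℂ))
      (P := fun ε z => z ∈ U ε ∧ AnalyticAt ℂ (fun x : ℂ × ℂ => y x.2 x.1) (z, ε))
      fun z hz => (hswap z).eventually (hloc z (hKU hz))
    obtain ⟨r, hr, H⟩ := Metric.eventually_nhds_iff_ball.1 hev
    exact ⟨r, hr, fun ε hε z hz => (H ε hε z hz).1, fun x hx => (H x.2 hx.2 x.1 hx.1).2⟩
  · rw [Metric.tendstoUniformlyOn_iff]
    intro η hη
    have hev := hK.eventually_forall_of_forall_eventually (x₀ := (0 : ℂ))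
      (P := fun ε z => dist (y 0 z) (y ε z) < η) fun z hz => by
        have hc : ContinuousAt (fun x : ℂ × ℂ => y x.2 x.1) (z, 0) :=
          (hloc z (hKU hz)).self_of_nhds.2.continuousAt
        have h1 : Tendsto (fun x : ℂ × ℂ => y x.1 x.2) (𝓝 (0, z)) (𝓝 (y 0 z)) :=
          hc.tendsto.comp (hswap z)
        have h2 : Tendsto (fun x : ℂ × ℂ => y 0 x.2) (𝓝 (0, z)) (𝓝 (y 0 z)) :=
          (((hy 0).isSolution.analytic z (hKU hz)).continuousAt.tendsto).comp
            continuous_snd.continuousAt.tendsto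
        have h3 := h2.dist h1
        rw [dist_self] at h3
        exact h3.eventually_lt_const hη
    filter_upwards [hev] with ε h z hz
    rw [hyI0 z hz]
    exact h z hz
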